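/- **Setting.** Let $\mathcal X$ be a set of contexts and $\mathcal A$ a countable set of actions; a policy is a map $\pi:\mathcal X\to\Delta_{\mathcal A}$ to probability distributions on $\mathcal A$. An environment $\mathbb B$ prescribes, for every round $t$ and every sequence of its previous moves, a set of permitted laws for its next move, i.e. a context $x_t$ together with a reward function $r_t(\cdot,x_t):\mathcal A\to[0,1]$. In each round it draws its move from a permitted law, chosen in dependence on everything that happened before the round (stochastic environments, oblivious sequences and restricted or unrestricted adaptive adversaries are special cases). For a set $\mathcal T$ of rounds, a policy class $\Pi'$ and played actions $a_\ell$, $\operatorname{Reg}(\mathcal T,\Pi')=\sup_{\pi\in\Pi'}\sum_{\ell\in\mathcal T}\big(\mathbb E_{a\sim\pi(\cdot|x_\ell)}[r_\ell(a,x_\ell)]-r_\ell(a_\ell,x_\ell)\big)$, and $\operatorname{Reg}(t,\Pi')=\operatorname{Reg}(\{1,\dots,t\},\Pi')$. A learner with policy class $\Pi$ selects in each round a policy $\pi_t\in\Pi$, possibly at random, from its history, simultaneously with the environment's move; then it draws $a_t\sim\pi_t(\cdot|x_t)$ and observes $x_t$ and a feedback $o_t$. Fix a failure probability $\delta\in(0,1)$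 and a constant $c>0$. In the importance-sampled protocol with a known rate $\rho\in(0,1]$ the feedback is $o_t=b_t r_t(a_t,x_t)/\rho$ with independent $b_t\sim\mathrm{Bernoulli}(\rho)$. Let $\Pi_1\subseteq\dots\subseteq\Pi_M$, $M\ge1$, be policy classes. For $i\in[M]$ let base learner $\mathbb A_i$ work on the action set $\mathcal A\cup\{\tilde a_{i+1},\dots,\tilde a_M\}$ with a policy class $\tilde\Pi_i\supseteq\Pi_i\cup\{\mathbf 1_{\tilde a_{i+1}},\dots,\mathbf 1_{\tilde a_M}\}$ of complexity $R(\tilde\Pi_i)$, where $1\le R(\tilde\Pi_1)\le\dots\le R(\tilde\Pi_M)$. Call $\mathbb A_i$ *h-stable and extendable* (in $\mathbb B$, against $\Pi_M$) if for every $\rho\in(0,1]$ and every extension of $\mathbb B$ in which the rewards in $[0,1]$ of the extra actions are set arbitrarily, depending on the entire past and on the current move of $\mathbb B$ but not on the learner's current draw, the following holds. Whenever $\mathbb A_i$ is run in the importance-sampled protocol, started afresh after a random number $\tau$ of rounds and run until a time $\sigma\le\infty$ ($\tau,\sigma$ stopping times; $\tau=0,\sigma=\infty$ is the plain case), with probability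 at least $1-\delta$, simultaneously for all $t$ with $\tau<t\le\sigma$, $$\operatorname{Reg}\big(\{\tau+1,\dots,t\},\ \Pi_M\cup\{\mathbf 1_{\tilde a_{i+1}},\dots,\mathbf 1_{\tilde a_M}\}\big)\le c\,R(\tilde\Pi_i)\sqrt{\tfrac{t-\tau}{\rho}\ln\tfrac{t-\tau}{\delta}} .$$ Let $i_\star$ be the smallest index such that $\mathbb A_i$ is h-stable and extendable for all $i\ge i_\star$ (assumed to exist). So $i_\star$ is the smallest index of an h-stable and extendable learner whenever all learners above that one are h-stable and extendable too. **Algorithm.** $\textsf{Arbe}(\delta,s,t_0)$ initializes $\mathbb A_s,\dots,\mathbb A_M$ afresh after round $t_0$ and sets $\rho_i=R(\tilde\Pi_i)^{-2}/\sum_{j=s}^M R(\tilde\Pi_j)^{-2}$ for $i\ge s$. In each round $t>t_0$ every active $\mathbb A_i$, run with rate $\rho_i$, proposes an action $a^i_t\sim\pi^i_t(\cdot|x_t)$, where $\tilde a_j$ stands for the action proposed by $\mathbb A_j$ (resolved recursively); an index $b_t$ is drawn independently with $\Pr[b_t=i]=\rho_i$; the resolved action $a_t=a_t^{b_t}$ is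 played; and each active $\mathbb A_i$ gets the feedback $\mathbf 1\{b_t=i\}\,r_t(a_t,x_t)/\rho_i$. Let $\widetilde{\operatorname{CRew}}_i(t_0,t)=\sum_{\ell=t_0+1}^t \mathbf 1\{b_\ell=i\}r_\ell(a_\ell,x_\ell)/\rho_i$ and $$D_i(t_0,t)=1.44\sqrt{\tfrac{t-t_0}{\rho_i}\lambda}+\tfrac{0.41}{\rho_i}\lambda,\qquad \lambda=1.4\ln\ln(4(t-t_0))+\ln\tfrac{5.2}{\delta}.$$ If after round $t$ there are $s\le i<j\le M$ with $$\widetilde{\operatorname{CRew}}_j(t_0,t)>\widetilde{\operatorname{CRew}}_i(t_0,t)+D_i(t_0,t)+D_j(t_0,t)+c\,R(\tilde\Pi_i)\sqrt{\tfrac{t-t_0}{\rho_i}\ln\tfrac t\delta},$$ the algorithm restarts as $\textsf{Arbe}(\delta,i+1,t)$ for one such $i$ (ties broken arbitrarily). **Theorem (Arbe regret bound).** There are a polynomial $p$ and, for every $c>0$, a constant $C>0$ that depends on $c$ only, such that in the above setting (for all $\mathcal X,\mathcal A,M,\mathbb B,\Pi_i,\mathbb A_i,R(\tilde\Pi_i),\delta$)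 every run of $\textsf{Arbe}(\delta,1,0)$ satisfies, with probability at least $1-p(M)\,\delta$, simultaneously for all $t\ge i_\star$, $$\operatorname{Reg}(t,\Pi_M)\le C\left(\frac{R(\tilde\Pi_{i_\star})}{R(\tilde\Pi_1)}\sqrt{i_\star}+M\right)R(\tilde\Pi_{i_\star})\sqrt{i_\star\, t\,\ln\frac t\delta}\,.$$ -/

import Mathlib

open MeasureTheory ProbabilityTheory

/-! ### Policies, expected rewards, regret

Rounds are numbered `0, 1, 2, …`; "after `t` rounds" means that rounds `0, …, t - 1` were played.
A start time `t₀` is the number of rounds played before the start, so the rounds of an epoch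
that starts at `t₀`, up to time `t`, are those of `Finset.Ico t₀ t`. -/

/-- A policy maps contexts to probability distributions over the (countable) action set. -/
abbrev Policy (X A : Type) : Type := X → PMF A

/-- The expected reward of a policy in context `x`, for the reward function `r = r_t(·, x)`. -/
noncomputable def Policy.value {X A : Type} (π : Policy X A) (x : X) (r : A → ℝ) : ℝ :=
  ∑' a, (π x a).toReal * r a

/-- The regret, in rounds `t₀, …, t - 1`, of the actions `a` against the policy class `P`;
`r ℓ a` stands for the reward of action `a` in round `ℓ` and context `x ℓ`. -/
noncomputable def regret {X A : Type} (P : Set (Policy X A)) (x : ℕ → X) (r : ℕ → A → ℝ)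
    (a : ℕ → A) (t₀ t : ℕ) : EReal :=
  ⨆ π ∈ P, ((∑ l ∈ Finset.Ico t₀ t, (Policy.value π (x l) (r l) - r l (a l)) : ℝ) : EReal)

/-- A policy, viewed on the action set extended by the special actions `K`. -/
noncomputable def Policy.extend {X A : Type} (K : Type) (π : Policy X A) : Policy X (A ⊕ K) :=
  fun x => (π x).map Sum.inl

/-- The policy that always plays the special action `k`. -/
noncomputable def Policy.special (X A : Type) {K : Type} (k : K) : Policy X (A ⊕ K) :=
  fun _ => PMF.pure (Sum.inr k)

/-- The policies of `P`, together with the single-action policies of all special actions. -/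
def extendClass {X A : Type} (K : Type) (P : Set (Policy X A)) : Set (Policy X (A ⊕ K)) :=
  Policy.extend K '' P ∪ Set.range (Policy.special X A)

/-! ### Learners -/

/-- A (randomized) bandit algorithm. In each round it draws a choice `θ` from a distribution that
depends on its own history, plays the policy `policy θ` of its policy class, and observes the
context, its action and a number (the feedback `o`). The sampling rate `ρ` of the feedback is
known to the algorithm. -/
structure Learner (X A : Type) [MeasurableSpace X] [MeasurableSpace A] where
  /-- the policy class of the algorithm -/
  policyClass : Set (Policy X A)
  /-- the set in which the random choices of the algorithm live -/
  Choice : Type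
  [mChoice : MeasurableSpace Choice]
  /-- the policy that belongs to a choice -/
  policy : Choice → Policy X A
  policy_mem : ∀ θ, policy θ ∈ policyClass
  policy_measurable : ∀ a, Measurable fun p : Choice × X => policy p.1 p.2 a
  /-- the law of the next choice after `n` rounds, given the history of choices, contexts,
  actions and feedback -/
  select : ℝ → (n : ℕ) → Kernel (Fin n → Choice × X × A × ℝ) Choice
  select_markov : ∀ ρ n, IsMarkovKernel (select ρ n)

attribute [instance] Learner.mChoice Learner.select_markov

/-- What an algorithm sees in a round: its choice, the context, its action, the feedback. -/
abbrev Learner.Obs {X A : Type} [MeasurableSpace X] [MeasurableSpace A] (L : Learner X A) : Type :=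
  L.Choice × X × A × ℝ

/-- The entries `t₀, …, t - 1` of a sequence. -/
def history {O : Type} (o : ℕ → O) (t₀ t : ℕ) : Fin (t - t₀) → O := fun k => o (t₀ + k)

/-- The probability that, after history `h` and in context `x`, the algorithm makes a choice
in `T` and then draws the action `a` from the chosen policy. -/
noncomputable def Learner.drawProb {X A : Type} [MeasurableSpace X] [MeasurableSpace A]
    (L : Learner X A) (ρ : ℝ) {n : ℕ} (h : Fin n → L.Obs) (x : X) (T : Set L.Choice) (a : A) : ℝ :=
  ∫ θ in T, (L.policy θ x a).toReal ∂(L.select ρ n h)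

/-! ### Environments -/

/-- The move of the environment in a round: a context and the rewards of all actions in it. -/
abbrev Move (X A : Type) : Type := X × (A → ℝ)

/-- An environment is given by the laws from which it may draw its move in round `t`, given its
previous moves. The environment picks one of the permitted laws, and this pick may depend
on everything that has happened so far. One permitted law: a stochastic or an oblivious
environment; all laws carried by a set of moves: an adaptive adversary restricted to that set. -/
abbrev Environment (X A : Type) [MeasurableSpace X] [MeasurableSpace A] : Type :=
  (t : ℕ) → (Fin t → Move X A) → Set (ProbabilityMeasure (Move X A))

/-- The contexts `x` and rewards `r` are generated by the environment `B`. Here `F t` is the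
information of the past before round `t`, and `G t` contains moreover the move of round `t`. -/
structure IsEnvironmentProcess {X A Ω : Type} [MeasurableSpace X] [MeasurableSpace A]
    [mΩ : MeasurableSpace Ω] (B : Environment X A) (μ : Measure Ω) (F G : ℕ → MeasurableSpace Ω)
    (x : ℕ → Ω → X) (r : ℕ → Ω → A → ℝ) : Prop where
  F_le_G : ∀ t, F t ≤ G t
  G_le_F_succ : ∀ t, G t ≤ F (t + 1)
  F_le : ∀ t, F t ≤ mΩ
  measurable_context : ∀ t, Measurable[G t] (x t)
  measurable_reward : ∀ t, Measurable[G t] (r t)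
  reward_mem : ∀ t ω a, r t ω a ∈ Set.Icc (0 : ℝ) 1
  law : ∀ t, ∃ κ : Ω → ProbabilityMeasure (Move X A),
    (∀ᵐ ω ∂μ, κ ω ∈ B t (fun l => (x l ω, r l ω))) ∧
    ∀ S : Set (Move X A), MeasurableSet S →
      μ[Set.indicator {ω | (x t ω, r t ω) ∈ S} (fun _ => (1 : ℝ)) | F t]
        =ᵐ[μ] fun ω => (κ ω : Measure (Move X A)).real S

/-! ### h-stability and extendability -/

/-- The interaction of a learner with an extension of the environment `B` to the action set
`A ⊕ K`, in the protocol with importance-sampled feedback of rate `ρ`. The rewards of the special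
actions `K` are arbitrary numbers in `[0, 1]`, fixed before the learner draws its action.
The learner is started at time `start` and ends at time `finish`
(`start = 0` and `finish = ⊤` being the plain case); both are stopping times. -/
structure StableRun {X A K Ω : Type} [MeasurableSpace X] [MeasurableSpace A] [MeasurableSpace K]
    [mΩ : MeasurableSpace Ω] (B : Environment X A) (L : Learner X (A ⊕ K)) (ρ : ℝ)
    (μ : Measure Ω) where
  /-- information before round `t` -/
  F : ℕ → MeasurableSpace Ω
  /-- information before round `t`, and the move of the environment in round `t` -/
  G : ℕ → MeasurableSpace Ω
  /-- contexts -/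
  x : ℕ → Ω → X
  /-- rewards -/
  r : ℕ → Ω → A ⊕ K → ℝ
  /-- the choice of the learner -/
  choice : ℕ → Ω → L.Choice
  /-- the action of the learner -/
  act : ℕ → Ω → A ⊕ K
  /-- is the reward shown to the learner? -/
  b : ℕ → Ω → Bool
  start : Ω → ℕ∞
  finish : Ω → ℕ∞
  env : IsEnvironmentProcess B μ F G x (fun t ω a => r t ω (Sum.inl a))
  measurable_reward : ∀ t, Measurable[G t] (r t)
  reward_mem : ∀ t ω a, r t ω a ∈ Set.Icc (0 : ℝ) 1
  measurable_choice : ∀ t, Measurable[F (t + 1)] (choice t)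
  measurable_act : ∀ t, Measurable[F (t + 1)] (act t)
  measurable_b : ∀ t, Measurable[F (t + 1)] (b t)
  measurable_start : ∀ t : ℕ, MeasurableSet[F t] {ω | start ω ≤ t}
  measurable_finish : ∀ t : ℕ, MeasurableSet[F t] {ω | finish ω ≤ t}
  /-- while it is active, the learner draws its choice and action as it prescribes, and its
  reward is shown to it with probability `ρ`, independently of all else -/
  draw : ∀ (t : ℕ) (T : Set L.Choice) (α : A ⊕ K) (β : Bool), MeasurableSet T →
    ∀ᵐ ω ∂μ, ∀ t₀ : ℕ, start ω = t₀ → t₀ ≤ t → (t : ℕ∞) < finish ω →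
      (μ[Set.indicator {ω' | choice t ω' ∈ T ∧ act t ω' = α ∧ b t ω' = β}
          (fun _ => (1 : ℝ)) | G t]) ω
        = L.drawProb ρ
            (history (fun l => (choice l ω, x l ω, act l ω,
              if b l ω then r l ω (act l ω) / ρ else 0)) t₀ t) (x t ω) T α
          * (if β then ρ else 1 - ρ)

/-- The learner `L`, which works on the action set `A` extended by the special actions `K`,
is h-stable against the policy class `P` and all special actions, in every extension of the
environment `B` (for `K` empty: it is h-stable in `B` against `P`). The number `R` is the
complexity of its policy class, `c` the constant that the `O`-notation hides, `δ` the failure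
probability. -/
def ExtHStable {X A K : Type} [MeasurableSpace X] [MeasurableSpace A] [MeasurableSpace K]
    (B : Environment X A) (L : Learner X (A ⊕ K)) (P : Set (Policy X A)) (R c δ : ℝ) : Prop :=
  ∀ ρ : ℝ, 0 < ρ → ρ ≤ 1 →
    ∀ (Ω : Type) [MeasurableSpace Ω] (μ : Measure Ω) [IsProbabilityMeasure μ]
      (run : StableRun B L ρ μ),
      μ {ω | ¬ ∀ t₀ t : ℕ, run.start ω = t₀ → t₀ < t → (t : ℕ∞) ≤ run.finish ω →
          regret (extendClass K P) (fun l => run.x l ω) (fun l => run.r l ω)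
              (fun l => run.act l ω) t₀ t
            ≤ ((c * (R * √((t - t₀ : ℝ) / ρ * Real.log ((t - t₀ : ℝ) / δ))) : ℝ) : EReal)}
        ≤ ENNReal.ofReal δ

/-! ### The algorithm -/

/-- The linked actions of base learner `i`: one for each base learner of larger index. -/
abbrev Linked {M : ℕ} (i : Fin M) : Type := {j : Fin M // i < j}

/-- The original action that the proposal of base learner `i` stands for: a linked action of `j`
stands for what the proposal of base learner `j` stands for. -/
def resolve {A : Type} {M : ℕ} (act : (i : Fin M) → A ⊕ Linked i) (i : Fin M) : A :=
  match act i with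
  | Sum.inl a => a
  | Sum.inr j => resolve act j.1
termination_by M - i.val
decreasing_by
  have _h1 : i.val < j.1.val := j.2
  have _h2 := j.1.isLt
  omega

/-- The sampling probabilities, when `s` is the smallest active index. -/
noncomputable def samplingProb {M : ℕ} (R : Fin M → ℝ) (s i : Fin M) : ℝ :=
  if s ≤ i then (R i ^ 2)⁻¹ / ∑ j ∈ Finset.Ici s, (R j ^ 2)⁻¹ else 0

/-- The confidence width after `n` rounds of an epoch, for sampling probability `ρ`. -/
noncomputable def confWidth (δ ρ : ℝ) (n : ℕ) : ℝ :=
  1.44 * √(n / ρ * (1.4 * Real.log (Real.log (4 * n)) + Real.log (5.2 / δ)))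
    + 0.41 / ρ * (1.4 * Real.log (Real.log (4 * n)) + Real.log (5.2 / δ))

/-- The importance-weighted reward estimate of base learner `i` in rounds `t₀, …, t - 1`, from the
sampled indices `b` and the received rewards `y`. -/
noncomputable def rewardEstimate {M : ℕ} (ρ : ℝ) (i : Fin M) (b : ℕ → Fin M) (y : ℕ → ℝ)
    (t₀ t : ℕ) : ℝ :=
  ∑ l ∈ Finset.Ico t₀ t, (if b l = i then y l / ρ else 0)

/-- The misspecification test for `i` and `j`, at time `t` in an epoch that started at time `t₀`
with smallest active index `s`. The constant `c` is the one of the stability bound. -/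
def TestTriggers {M : ℕ} (R : Fin M → ℝ) (c δ : ℝ) (b : ℕ → Fin M) (y : ℕ → ℝ) (s : Fin M)
    (t₀ t : ℕ) (i j : Fin M) : Prop :=
  s ≤ i ∧ i < j ∧
    rewardEstimate (samplingProb R s i) i b y t₀ t
      + confWidth δ (samplingProb R s i) (t - t₀) + confWidth δ (samplingProb R s j) (t - t₀)
      + c * (R i * √((t - t₀ : ℝ) / samplingProb R s i * Real.log (t / δ)))
    < rewardEstimate (samplingProb R s j) j b y t₀ t

/-- A run of the algorithm (from time `0`, with all `M` base learners) in the environment `B`.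
The base learners `L i` work on the action sets extended by the linked actions, `R i` is the
complexity of the (extended) policy class of `L i`. -/
structure ArbeRun {X A Ω : Type} {M : ℕ} [MeasurableSpace X] [MeasurableSpace A]
    [mΩ : MeasurableSpace Ω] (B : Environment X A) (L : (i : Fin M) → Learner X (A ⊕ Linked i))
    (R : Fin M → ℝ) (c δ : ℝ) (μ : Measure Ω) where
  /-- information before round `t` -/
  F : ℕ → MeasurableSpace Ω
  /-- information before round `t`, and the move of the environment in round `t` -/
  G : ℕ → MeasurableSpace Ω
  /-- contexts -/
  x : ℕ → Ω → X
  /-- rewards of the original actions -/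
  r : ℕ → Ω → A → ℝ
  /-- the choices of the base learners -/
  choice : ℕ → Ω → (i : Fin M) → (L i).Choice
  /-- the actions that the base learners propose -/
  act : ℕ → Ω → (i : Fin M) → A ⊕ Linked i
  /-- the base learner that is followed -/
  b : ℕ → Ω → Fin M
  /-- the smallest active index in round `t` -/
  s : ℕ → Ω → Fin M
  /-- the start time of the epoch to which round `t` belongs -/
  start : ℕ → Ω → ℕ
  env : IsEnvironmentProcess B μ F G x r
  measurable_choice : ∀ t i, Measurable[F (t + 1)] (fun ω => choice t ω i)
  measurable_act : ∀ t i, Measurable[F (t + 1)] (fun ω => act t ω i)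
  measurable_b : ∀ t, Measurable[F (t + 1)] (b t)
  measurable_s : ∀ t, Measurable[F t] (s t)
  measurable_start : ∀ t, Measurable[F t] (start t)
  s_zero : ∀ ω, (s 0 ω : ℕ) = 0
  start_zero : ∀ ω, start 0 ω = 0
  /-- given the past and the move of the environment, the active base learners draw their
  choices and actions as they prescribe, from their histories since the start of the epoch, the
  index `b` is drawn from the sampling probabilities, and all these draws are independent -/
  draw : ∀ (t : ℕ) (s₀ : Fin M) (T : (i : Fin M) → Set (L i).Choice)
      (α : (i : Fin M) → A ⊕ Linked i) (k : Fin M), (∀ i, MeasurableSet (T i)) →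
    ∀ᵐ ω ∂μ, s t ω = s₀ →
      (μ[Set.indicator {ω' | (∀ i, s₀ ≤ i → choice t ω' i ∈ T i ∧ act t ω' i = α i) ∧ b t ω' = k}
          (fun _ => (1 : ℝ)) | G t]) ω
        = (∏ i ∈ Finset.Ici s₀,
            (L i).drawProb (samplingProb R s₀ i)
              (history (fun l => (choice l ω i, x l ω, act l ω i,
                if b l ω = i then r l ω (resolve (act l ω) i) / samplingProb R s₀ i else 0))
                (start t ω) t) (x t ω) (T i) (α i))
          * samplingProb R s₀ k
  /-- no restart if no test triggers -/
  step_continue : ∀ t ω,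
    (∀ i j, ¬ TestTriggers R c δ (fun l => b l ω)
        (fun l => r l ω (resolve (act l ω) (b l ω))) (s t ω) (start t ω) (t + 1) i j) →
      s (t + 1) ω = s t ω ∧ start (t + 1) ω = start t ω
  /-- restart above some index whose test triggers (ties broken in any way) -/
  step_restart : ∀ t ω,
    (∃ i j, TestTriggers R c δ (fun l => b l ω)
        (fun l => r l ω (resolve (act l ω) (b l ω))) (s t ω) (start t ω) (t + 1) i j) →
      ∃ i j, TestTriggers R c δ (fun l => b l ω)
          (fun l => r l ω (resolve (act l ω) (b l ω))) (s t ω) (start t ω) (t + 1) i j ∧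
        (s (t + 1) ω : ℕ) = i + 1 ∧ start (t + 1) ω = t + 1

/-- The action that the algorithm plays in round `t`. -/
def ArbeRun.played {X A Ω : Type} {M : ℕ} [MeasurableSpace X] [MeasurableSpace A]
    [MeasurableSpace Ω] {B : Environment X A} {L : (i : Fin M) → Learner X (A ⊕ Linked i)}
    {R : Fin M → ℝ} {c δ : ℝ} {μ : Measure Ω} (run : ArbeRun B L R c δ μ) (t : ℕ) (ω : Ω) : A :=
  resolve (run.act t ω) (run.b t ω)

/-! The proof splits into a random part, which shows that a good event is likely, and a
deterministic regret analysis on it. On the good event, every base learner from `istar` on, in every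
epoch where it is active, has accurate importance-weighted estimates and satisfies its stability
bound, also against the linked actions.

Random part. A restart strictly increases the smallest active index, so an epoch is labelled by this
index `s`, and at most M² pairs of a label and a base learner occur. For a fixed pair `(s, j)`,
learner `j` during that epoch runs in an extension of the environment: the reward of a linked action
is the reward of what the linked learner's proposal resolves to, and the epoch lies between two
stopping times (`ArbeRun.toStableRun`). These rewards depend on the other learners' draws in the
same round, so those draws must become part of the environment's move. The draw of `j` keeps its law
after this refinement by conditional independence (`condExp_sup_comap_ae_eq`). Hence `ExtHStable`
applies to `j`. The estimates are controlled by a Bernstein supermartingale, Ville's inequality and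
stitching over dyadic epoch lengths (`StableRun.measure_exists_err_gt`). A union bound over the
pairs gives `ArbeRun.measure_not_good_le`.

Deterministic part. If `i ≥ istar`, stability of `i` against the linked action of `j` says that the
proposals of `j` cannot collect much more than those of `i`. With the confidence widths added, this
is the negation of the test, so no such `i` is discarded (`ArbeRun.Good.s_le`) and there are at most
`istar + 1` epochs. Inside an epoch, a learner `i ≥ istar` competes with the benchmark by its own
stability; a learner `i < istar`, about which nothing is assumed, competes because the test against
`istar` has not triggered. The played reward dominates the `ρ`-weighted sum of the estimates
pointwise, so no further concentration is needed. As `ρ_i` is proportional to `R_i⁻²`, the weight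
`ρ_i` turns the stability term of size `R_i / √ρ_i` into the same quantity for all `i`, while the
price of comparing with `istar` involves `1 / √ρ_istar`, which is at most `R_istar / R_0 * √(istar +
1) + M`. Cauchy–Schwarz over the epochs gives the remaining factor `√(istar + 1)`. -/

/-! ### Conditional probabilities given a countable refinement -/

/-- On the event `E = {Z = v}` the σ-algebras `G` and `G ⊔ σ(Z)` have the same traces. -/
theorem exists_measurableSet_inter_fiber_eq {Ω S : Type*} [MeasurableSpace S]
    {G : MeasurableSpace Ω} {Z : Ω → S} (v : S) {s : Set Ω}
    (hs : MeasurableSet[G ⊔ MeasurableSpace.comap Z inferInstance] s) :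
    ∃ B, MeasurableSet[G] B ∧ s ∩ Z ⁻¹' {v} = B ∩ Z ⁻¹' {v} := by
  rw [MeasurableSpace.measurableSet_sup] at hs
  induction hs with
  | basic u hu =>
    rcases hu with hu | ⟨W, -, rfl⟩
    · exact ⟨u, hu, rfl⟩
    · by_cases hv : v ∈ W
      · refine ⟨Set.univ, MeasurableSet.univ, ?_⟩
        ext ω; simp only [Set.mem_inter_iff, Set.mem_preimage, Set.mem_singleton_iff, Set.mem_univ]
        constructor
        · exact fun h => ⟨trivial, h.2⟩
        · exact fun h => ⟨h.2 ▸ hv, h.2⟩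
      · refine ⟨∅, MeasurableSet.empty, ?_⟩
        ext ω; simp only [Set.mem_inter_iff, Set.mem_preimage, Set.mem_singleton_iff,
          Set.mem_empty_iff_false, false_and, iff_false]
        exact fun h => hv (h.2 ▸ h.1)
  | empty => exact ⟨∅, MeasurableSet.empty, rfl⟩
  | compl u _ ih =>
    obtain ⟨B, hB, h⟩ := ih
    refine ⟨Bᶜ, hB.compl, ?_⟩
    ext ω
    have := Set.ext_iff.1 h ω
    simp only [Set.mem_inter_iff, Set.mem_compl_iff] at this ⊢
    tauto
  | iUnion u _ ih =>
    choose B hB h using ih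
    exact ⟨⋃ n, B n, MeasurableSet.iUnion hB, by simp only [Set.iUnion_inter, h]⟩

/-- Bayes' rule on a fiber: a set of the refined σ-algebra agrees on the fiber with a set of `G`, so
the defining integrals need only be tested on `G`. There the indicator of the fiber averages to `P`,
and `N / P` times `P` is `N`. -/
theorem condExp_indicator_inter_fiber {Ω S : Type*} [MeasurableSpace S] {G mΩ : MeasurableSpace Ω}
    {μ : Measure Ω} [IsProbabilityMeasure μ] (hG : G ≤ mΩ) {Z : Ω → S}
    (hZ : Measurable Z) {v : S} (hv : MeasurableSet {v}) {H : Set Ω} (hH : MeasurableSet H) :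
    μ[(H ∩ Z ⁻¹' {v}).indicator (fun _ => (1 : ℝ)) | G ⊔ MeasurableSpace.comap Z inferInstance]
      =ᵐ[μ] (Z ⁻¹' {v}).indicator
        (μ[(H ∩ Z ⁻¹' {v}).indicator (fun _ => (1 : ℝ)) | G]
          / μ[(Z ⁻¹' {v}).indicator (fun _ => (1 : ℝ)) | G]) := by
  set E := Z ⁻¹' {v} with hE
  have hEm : MeasurableSet E := hZ hv
  set N := μ[(H ∩ E).indicator (fun _ => (1 : ℝ)) | G] with hN
  set P := μ[E.indicator (fun _ => (1 : ℝ)) | G] with hP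
  have hle : G ⊔ MeasurableSpace.comap Z inferInstance ≤ mΩ := sup_le hG hZ.comap_le
  have iHE : Integrable ((H ∩ E).indicator (fun _ => (1 : ℝ))) μ :=
    (integrable_const 1).indicator (hH.inter hEm)
  have iE : Integrable (E.indicator (fun _ => (1 : ℝ))) μ := (integrable_const 1).indicator hEm
  have h0 : 0 ≤ᵐ[μ] N := condExp_nonneg
    (Filter.Eventually.of_forall fun ω => Set.indicator_nonneg (fun _ _ => zero_le_one) ω)
  have hNP : N ≤ᵐ[μ] P := condExp_mono iHE iE (Filter.Eventually.of_forall fun ω =>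
    Set.indicator_le_indicator_of_subset Set.inter_subset_right (fun _ => zero_le_one) ω)
  have mNP : StronglyMeasurable[G] (N / P) :=
    (stronglyMeasurable_condExp.measurable.div stronglyMeasurable_condExp.measurable).stronglyMeasurable
  have bound : ∀ᵐ ω ∂μ, ‖(N / P) ω‖ ≤ 1 := by
    filter_upwards [h0, hNP] with ω h1 h2
    have h1' : 0 ≤ N ω := h1
    rw [Pi.div_apply, Real.norm_of_nonneg (div_nonneg h1' (h1'.trans h2))]
    exact div_le_one_of_le₀ h2 (h1'.trans h2)
  have mNP' : AEStronglyMeasurable (N / P) μ := (mNP.mono hG).aestronglyMeasurable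
  have iNP : Integrable (N / P) μ := Integrable.of_bound mNP' 1 bound
  have iENP : Integrable (E.indicator (N / P)) μ := iNP.indicator hEm
  refine (ae_eq_condExp_of_forall_setIntegral_eq hle iHE (fun s _ _ => iENP.integrableOn) ?_ ?_).symm
  · intro s hs _
    obtain ⟨B, hB, hsB⟩ := exists_measurableSet_inter_fiber_eq v hs
    have key : μ[E.indicator (N / P) | G] =ᵐ[μ] N := by
      have e1 : E.indicator (N / P) = E.indicator (fun _ => (1 : ℝ)) * (N / P) := by
        ext ω; by_cases h : ω ∈ E <;> simp [h]
      have e2 := condExp_mul_of_stronglyMeasurable_right (μ := μ) mNP (e1 ▸ iENP) iE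
      rw [e1]
      filter_upwards [e2, h0, hNP] with ω e2 h1 h2
      rw [e2, ← hP, Pi.mul_apply, Pi.div_apply]
      -- Where `P` vanishes so does `N ≤ P`, hence division by zero does no harm.
      by_cases hp : P ω = 0
      · have h1' : 0 ≤ N ω := h1
        rw [hp] at h2 ⊢; simp [le_antisymm h2 h1']
      · field_simp
    calc ∫ ω in s, E.indicator (N / P) ω ∂μ = ∫ ω in B, E.indicator (N / P) ω ∂μ := by
          rw [setIntegral_indicator hEm, setIntegral_indicator hEm, hsB]
      _ = ∫ ω in B, N ω ∂μ := by
          rw [← setIntegral_condExp hG iENP hB]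
          exact setIntegral_congr_ae (hG _ hB) (key.mono fun ω h _ => h)
      _ = ∫ ω in B, (H ∩ E).indicator (fun _ => (1 : ℝ)) ω ∂μ := setIntegral_condExp hG iHE hB
      _ = ∫ ω in s, (H ∩ E).indicator (fun _ => (1 : ℝ)) ω ∂μ := by
          rw [setIntegral_indicator (hH.inter hEm), setIntegral_indicator (hH.inter hEm)]
          congr 2
          rw [Set.inter_comm H, ← Set.inter_assoc, ← Set.inter_assoc, hsB]
  · refine StronglyMeasurable.aestronglyMeasurable (StronglyMeasurable.indicator
      (mNP.mono
      (le_sup_left : G ≤ G ⊔ MeasurableSpace.comap Z inferInstance)) ?_)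
    exact (le_sup_right : _ ≤ G ⊔ MeasurableSpace.comap Z inferInstance) _ ⟨{v}, hv, rfl⟩

/-- If, given `G`, the event `H` has conditional probability `q` and is independent of the
countably valued `Z`, then it has conditional probability `q` given `G` and `Z`. -/
theorem condExp_sup_comap_ae_eq {Ω S : Type*} [MeasurableSpace S] [Countable S]
    [MeasurableSingletonClass S] {G mΩ : MeasurableSpace Ω}
    {μ : Measure Ω} [IsProbabilityMeasure μ] (hG : G ≤ mΩ) {Z : Ω → S}
    (hZ : Measurable Z) {H : Set Ω} (hH : MeasurableSet H) {D : Set Ω} {q : Ω → ℝ}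
    (h : ∀ ω₁, ∃ p : Ω → ℝ, ∀ᵐ ω ∂μ, ω ∈ D →
      (μ[(H ∩ Z ⁻¹' {Z ω₁}).indicator (fun _ => (1 : ℝ)) | G]) ω = p ω * q ω ∧
      (μ[(Z ⁻¹' {Z ω₁}).indicator (fun _ => (1 : ℝ)) | G]) ω = p ω) :
    ∀ᵐ ω ∂μ, ω ∈ D →
      (μ[H.indicator (fun _ => (1 : ℝ)) | G ⊔ MeasurableSpace.comap Z inferInstance]) ω = q ω := by
  have hle : G ⊔ MeasurableSpace.comap Z inferInstance ≤ mΩ := sup_le hG hZ.comap_le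
  -- Only attained values of `Z` are considered, each represented by a point `ω₁`. In the
  -- application `ω₁` supplies proposals for all learners at once, including those that `Z` does not
  -- record.
  have main : ∀ v ∈ Set.range Z, ∀ᵐ ω ∂μ, Z ω = v → ω ∈ D →
      (μ[H.indicator (fun _ => (1 : ℝ)) | G ⊔ MeasurableSpace.comap Z inferInstance]) ω = q ω := by
    rintro v ⟨ω₁, rfl⟩
    obtain ⟨p, hp⟩ := h ω₁
    set E := Z ⁻¹' {Z ω₁} with hE
    have hEm : MeasurableSet E := hZ (measurableSet_singleton _)
    have hE' : MeasurableSet[G ⊔ MeasurableSpace.comap Z inferInstance] E :=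
      (le_sup_right : _ ≤ G ⊔ MeasurableSpace.comap Z inferInstance) _
        ⟨{Z ω₁}, measurableSet_singleton _, rfl⟩
    have iH : Integrable (H.indicator (fun _ => (1 : ℝ))) μ := (integrable_const 1).indicator hH
    have iE : Integrable (E.indicator (fun _ => (1 : ℝ))) μ := (integrable_const 1).indicator hEm
    have h1 := condExp_indicator (μ := μ) iH hE'
    have h2 := condExp_indicator_inter_fiber (μ := μ) hG hZ (measurableSet_singleton (Z ω₁)) hH
    have e : E.indicator (H.indicator (fun _ => (1 : ℝ))) = (H ∩ E).indicator (fun _ => 1) := by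
      rw [Set.indicator_indicator, Set.inter_comm]
    rw [e] at h1
    -- The part of `E` where `P` vanishes has measure `∫ P` over `{P = 0}`, which is zero; elsewhere
    -- on `E` the factor `p` cancels.
    have h3 : ∀ᵐ ω ∂μ, ω ∈ E → (μ[E.indicator (fun _ => (1 : ℝ)) | G]) ω ≠ 0 := by
      set P := μ[E.indicator (fun _ => (1 : ℝ)) | G] with hP
      have mP : MeasurableSet[G] {ω | P ω = 0} :=
        stronglyMeasurable_condExp.measurable (measurableSet_singleton 0)
      have : μ (E ∩ {ω | P ω = 0}) = 0 := by
        have e1 := setIntegral_condExp hG iE mP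
        rw [setIntegral_congr_fun (g := fun _ => (0 : ℝ)) (hG _ mP) (fun ω hω => hω),
          integral_zero, setIntegral_indicator hEm, setIntegral_const, smul_eq_mul, mul_one] at e1
        rw [Set.inter_comm]
        exact (measureReal_eq_zero_iff).1 e1.symm
      rw [ae_iff]
      convert this using 2
      ext ω; simp
    filter_upwards [h1, h2, h3, hp] with ω h1 h2 h3 hp hv hD
    have hωE : ω ∈ E := hv
    rw [h1, Set.indicator_of_mem hωE, Set.indicator_of_mem hωE] at h2
    obtain ⟨hp1, hp2⟩ := hp hD
    rw [h2, Pi.div_apply, hp1, hp2]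
    have := h3 hωE
    rw [hp2] at this
    field_simp
  have := (ae_ball_iff (Set.to_countable (Set.range Z))).2 main
  filter_upwards [this] with ω hω hD
  exact hω (Z ω) ⟨ω, rfl⟩ rfl hD

theorem lintegral_ofReal_condExp_indicator {Ω : Type*} {G mΩ : MeasurableSpace Ω}
    {μ : Measure Ω} [IsProbabilityMeasure μ] (hG : G ≤ mΩ) {E : Set Ω} (hE : MeasurableSet E) :
    ∫⁻ ω, ENNReal.ofReal ((μ[E.indicator (fun _ => (1 : ℝ)) | G]) ω) ∂μ = μ E := by
  have h0 : 0 ≤ᵐ[μ] μ[E.indicator (fun _ => (1 : ℝ)) | G] := condExp_nonneg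
    (Filter.Eventually.of_forall fun ω => Set.indicator_nonneg (fun _ _ => zero_le_one) ω)
  rw [← ofReal_integral_eq_lintegral_ofReal integrable_condExp h0, integral_condExp hG,
    integral_indicator hE, setIntegral_const, smul_eq_mul, mul_one, ofReal_measureReal]

/-- Conditional probabilities are countably additive. -/
theorem hasSum_condExp_indicator_inter_fiber {Ω S : Type*} [MeasurableSpace S] [Countable S]
    [MeasurableSingletonClass S] {G mΩ : MeasurableSpace Ω} {μ : Measure Ω}
    [IsProbabilityMeasure μ] (hG : G ≤ mΩ) {Y : Ω → S} (hY : Measurable Y) {E : Set Ω}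
    (hE : MeasurableSet E) :
    ∀ᵐ ω ∂μ, HasSum (fun v => (μ[(E ∩ Y ⁻¹' {v}).indicator (fun _ => (1 : ℝ)) | G]) ω)
      ((μ[E.indicator (fun _ => (1 : ℝ)) | G]) ω) := by
  have hEv : ∀ v, MeasurableSet (E ∩ Y ⁻¹' {v}) :=
    fun v => hE.inter (hY (measurableSet_singleton v))
  have nonneg : ∀ s : Set Ω, 0 ≤ᵐ[μ] μ[s.indicator (fun _ => (1 : ℝ)) | G] := fun s =>
    condExp_nonneg
      (Filter.Eventually.of_forall fun ω => Set.indicator_nonneg (fun _ _ => zero_le_one) ω)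
  have hle : ∀ s : Finset S, ∀ᵐ ω ∂μ,
      ∑ v ∈ s, (μ[(E ∩ Y ⁻¹' {v}).indicator (fun _ => (1 : ℝ)) | G]) ω
        ≤ (μ[E.indicator (fun _ => (1 : ℝ)) | G]) ω := by
    intro s
    have i1 : ∀ v ∈ s, Integrable ((E ∩ Y ⁻¹' {v}).indicator (fun _ => (1 : ℝ))) μ :=
      fun v _ => (integrable_const 1).indicator (hEv v)
    have i2 : Integrable (E.indicator (fun _ => (1 : ℝ))) μ := (integrable_const 1).indicator hE
    have h1 := condExp_finsetSum i1 G
    have h2 : μ[∑ v ∈ s, (E ∩ Y ⁻¹' {v}).indicator (fun _ => (1 : ℝ)) | G]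
        ≤ᵐ[μ] μ[E.indicator (fun _ => (1 : ℝ)) | G] := by
      refine condExp_mono (integrable_finsetSum' _ i1) i2 (Filter.Eventually.of_forall fun ω => ?_)
      rw [Finset.sum_apply]
      classical
      by_cases hω : ω ∈ E
      · rw [Set.indicator_of_mem hω]
        have : ∀ v ∈ s, (E ∩ Y ⁻¹' {v}).indicator (fun _ => (1 : ℝ)) ω
            = if Y ω = v then 1 else 0 := by
          intro v _; simp [Set.indicator_apply, hω]
        rw [Finset.sum_congr rfl this, Finset.sum_ite_eq]
        split_ifs <;> simp
      · rw [Set.indicator_of_notMem hω]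
        exact (Finset.sum_eq_zero fun v _ => Set.indicator_of_notMem (fun h => hω h.1) _).le
    filter_upwards [h1, h2] with ω h1 h2
    rwa [h1, Finset.sum_apply] at h2
  set F : Ω → ENNReal := fun ω =>
    ∑' v, ENNReal.ofReal ((μ[(E ∩ Y ⁻¹' {v}).indicator (fun _ => (1 : ℝ)) | G]) ω) with hF
  have hnn := ae_all_iff.2 fun v => nonneg (E ∩ Y ⁻¹' {v})
  have meas : ∀ s : Set Ω, Measurable
      (fun ω => ENNReal.ofReal ((μ[s.indicator (fun _ => (1 : ℝ)) | G]) ω)) := fun s =>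
    (stronglyMeasurable_condExp.measurable.mono hG le_rfl).ennreal_ofReal
  have hFle : F ≤ᵐ[μ] fun ω => ENNReal.ofReal ((μ[E.indicator (fun _ => (1 : ℝ)) | G]) ω) := by
    filter_upwards [ae_all_iff.2 hle, hnn] with ω h1 h2
    rw [hF]
    refine ENNReal.summable.tsum_le_of_sum_le fun s => ?_
    rw [← ENNReal.ofReal_sum_of_nonneg fun v _ => h2 v]
    exact ENNReal.ofReal_le_ofReal (h1 s)
  have hFint : ∫⁻ ω, F ω ∂μ = μ E := by
    rw [hF, lintegral_tsum fun v => (meas _).aemeasurable]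
    simp_rw [lintegral_ofReal_condExp_indicator hG (hEv _)]
    rw [← measure_iUnion (fun v w hvw => ?_) hEv, ← Set.inter_iUnion, ← Set.preimage_iUnion,
      Set.iUnion_of_singleton, Set.preimage_univ, Set.inter_univ]
    exact ((Set.disjoint_singleton.2 hvw).preimage Y).mono Set.inter_subset_right
      Set.inter_subset_right
  -- The series is at most the conditional probability of `E`, and both integrate to `μ E`; hence
  -- they agree almost everywhere.
  have hEq := ae_eq_of_ae_le_of_lintegral_le hFle (hFint ▸ measure_ne_top μ E)
    (meas E).aemeasurable (by rw [hFint, lintegral_ofReal_condExp_indicator hG hE])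
  filter_upwards [hEq, hnn, nonneg E] with ω h1 h2 h3
  have h4 : F ω ≠ ⊤ := h1 ▸ ENNReal.ofReal_ne_top
  have h5 := ENNReal.hasSum_toReal h4
  have h6 := congrArg ENNReal.toReal h1
  rw [ENNReal.toReal_ofReal h3, hF, ENNReal.tsum_toReal_eq (fun v => ENNReal.ofReal_ne_top)] at h6
  rw [h6] at h5
  simp_rw [fun v => ENNReal.toReal_ofReal (h2 v)] at h5
  exact h5

/-- The draw of a learner is an action with probability one. -/
theorem Learner.hasSum_drawProb {X A : Type} [MeasurableSpace X] [MeasurableSpace A] [Countable A]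
    (L : Learner X A) (ρ : ℝ) {n : ℕ} (h : Fin n → L.Obs) (x : X) :
    HasSum (fun a => L.drawProb ρ h x Set.univ a) 1 := by
  have m : ∀ a, Measurable fun θ => L.policy θ x a := fun a =>
    (L.policy_measurable a).comp (measurable_id.prodMk measurable_const)
  have e : ∀ a, L.drawProb ρ h x Set.univ a
      = (∫⁻ θ, L.policy θ x a ∂(L.select ρ n h)).toReal := fun a => by
    rw [Learner.drawProb, setIntegral_univ, integral_toReal (m a).aemeasurable
      (Filter.Eventually.of_forall fun θ => PMF.apply_lt_top _ _)]
  have s : ∑' a, ∫⁻ θ, L.policy θ x a ∂(L.select ρ n h) = 1 := by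
    rw [← lintegral_tsum fun a => (m a).aemeasurable]
    simp [PMF.tsum_coe]
  simp_rw [e]
  have h5 := ENNReal.hasSum_toReal (s ▸ ENNReal.one_ne_top)
  have h6 := ENNReal.tsum_toReal_eq
    (fun a => ENNReal.ne_top_of_tsum_ne_top (s ▸ ENNReal.one_ne_top) a)
  rw [s, ENNReal.toReal_one] at h6
  rwa [← h6] at h5

/-! ### The feedback coin is independent of the learner's draw. -/

section StableRun

variable {X A K Ω : Type} [MeasurableSpace X] [MeasurableSpace A] [MeasurableSpace K]
  [mΩ : MeasurableSpace Ω] {B : Environment X A} {L : Learner X (A ⊕ K)} {ρ : ℝ} {μ : Measure Ω}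

/-- The learner is active in round `t`. -/
def StableRun.active (run : StableRun B L ρ μ) (t : ℕ) : Set Ω :=
  {ω | run.start ω ≤ t ∧ (t : ℕ∞) < run.finish ω}

theorem StableRun.measurableSet_active (run : StableRun B L ρ μ) (t : ℕ) :
    MeasurableSet[run.F t] (run.active t) := by
  have : run.active t = {ω | run.start ω ≤ t} ∩ {ω | run.finish ω ≤ t}ᶜ := by
    ext ω; simp [StableRun.active]
  rw [this]
  exact MeasurableSet.inter (run.measurable_start t) (run.measurable_finish t).compl

theorem StableRun.G_le (run : StableRun B L ρ μ) (t : ℕ) : run.G t ≤ mΩ :=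
  (run.env.G_le_F_succ t).trans (run.env.F_le _)

/-- The information before the draw of `b t`: the past, the move of the environment and the
action of the learner. -/
abbrev StableRun.GAct (run : StableRun B L ρ μ) (t : ℕ) : MeasurableSpace Ω :=
  run.G t ⊔ MeasurableSpace.comap (run.act t) inferInstance

/-- Adding the draw rule over both values of the coin gives the law of the action alone, so the
joint law of action and coin is a product, and the refinement lemma applies with the action as `Z`.
-/
theorem StableRun.condExp_b [Countable A] [Countable K] [MeasurableSingletonClass (A ⊕ K)]
    [IsProbabilityMeasure μ] (run : StableRun B L ρ μ) (t : ℕ) :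
    ∀ᵐ ω ∂μ, ω ∈ run.active t →
      (μ[(run.b t ⁻¹' {true}).indicator (fun _ => (1 : ℝ)) | run.GAct t]) ω = ρ := by
  have mact : Measurable (run.act t) := (run.measurable_act t).mono (run.env.F_le _) le_rfl
  have mb : Measurable (run.b t) := (run.measurable_b t).mono (run.env.F_le _) le_rfl
  refine condExp_sup_comap_ae_eq (run.G_le t) mact (mb (measurableSet_singleton _))
    (q := fun _ => ρ) fun ω₁ => ?_
  -- On the active event `start` is finite, so `toNat` recovers it.
  refine ⟨fun ω => L.drawProb ρ
            (history (fun l => (run.choice l ω, run.x l ω, run.act l ω,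
              if run.b l ω then run.r l ω (run.act l ω) / ρ else 0)) (run.start ω).toNat t)
            (run.x t ω) Set.univ (run.act t ω₁), ?_⟩
  have hs := hasSum_condExp_indicator_inter_fiber (μ := μ) (run.G_le t) mb
    (mact (measurableSet_singleton (run.act t ω₁)))
  have e : ∀ β, {ω' | run.choice t ω' ∈ Set.univ ∧ run.act t ω' = run.act t ω₁ ∧ run.b t ω' = β}
      = run.act t ⁻¹' {run.act t ω₁} ∩ run.b t ⁻¹' {β} := fun β => by
    ext ω; simp
  have d := fun β => run.draw t Set.univ (run.act t ω₁) β MeasurableSet.univ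
  simp only [e] at d
  filter_upwards [d true, d false, hs] with ω h1 h2 hs hD
  obtain ⟨t₀, ht₀⟩ := ENat.ne_top_iff_exists.1 (ne_top_of_le_ne_top (ENat.natCast_ne_top t) hD.1)
  have ht : t₀ ≤ t := by have := hD.1; rw [← ht₀] at this; exact_mod_cast this
  have h1 := h1 t₀ ht₀.symm ht hD.2
  have h2 := h2 t₀ ht₀.symm ht hD.2
  have hs' := hs.unique (hasSum_fintype _)
  rw [Fintype.sum_bool, h1, h2] at hs'
  rw [Set.inter_comm, h1, hs', ← ht₀]
  simp
  ring

end StableRun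

/-! ### A maximal inequality and exponential moments -/

/-- Ville's maximal inequality for nonnegative supermartingales. -/
theorem mul_measure_exists_le_le_lintegral {Ω : Type*} {mΩ : MeasurableSpace Ω} {μ : Measure Ω}
    {F : ℕ → MeasurableSpace Ω} (hF : Monotone F) (hle : ∀ t, F t ≤ mΩ) {W : ℕ → Ω → ENNReal}
    (hW : ∀ t, Measurable[F t] (W t))
    (h : ∀ t s, MeasurableSet[F t] s → ∫⁻ ω in s, W (t + 1) ω ∂μ ≤ ∫⁻ ω in s, W t ω ∂μ)
    (a : ENNReal) : a * μ {ω | ∃ t, a ≤ W t ω} ≤ ∫⁻ ω, W 0 ω ∂μ := by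
  set E : ℕ → Set Ω := fun t => {ω | ∀ l < t, W l ω < a} with hE
  have hEsucc : ∀ t, E (t + 1) = E t ∩ {ω | W t ω < a} := by
    intro t; ext ω
    simp only [hE, Set.mem_ofPred_eq, Set.mem_inter_iff, Nat.lt_succ_iff_lt_or_eq, or_imp,
      forall_and, forall_eq]
  have mE : ∀ t, MeasurableSet[F t] (E t) := by
    intro t
    induction t with
    | zero => simp [hE]
    | succ t ih =>
      rw [hEsucc]
      exact (hF t.le_succ) _ (ih.inter (measurableSet_lt (hW t) measurable_const))
  -- `E t` says that level `a` was not reached before time `t`. This is optional stopping at the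
  -- first crossing: mass that has crossed is frozen at value at least `a`, the rest follows `W`.
  have claim : ∀ t, a * μ (E t)ᶜ + ∫⁻ ω in E t, W t ω ∂μ ≤ ∫⁻ ω, W 0 ω ∂μ := by
    intro t
    induction t with
    | zero => simp [hE]
    | succ t ih =>
      have m1 : MeasurableSet {ω | W t ω < a} :=
        hle t _ (measurableSet_lt (hW t) measurable_const)
      have m2 : MeasurableSet (E t) := hle t _ (mE t)
      have h1 : ∫⁻ ω in E (t + 1), W (t + 1) ω ∂μ ≤ ∫⁻ ω in E (t + 1), W t ω ∂μ :=
        h t _ (by rw [hEsucc]; exact (mE t).inter (measurableSet_lt (hW t) measurable_const))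
      have h2 : μ (E (t + 1))ᶜ ≤ μ (E t)ᶜ + μ (E t \ {ω | W t ω < a}) := by
        refine (measure_mono ?_).trans (measure_union_le _ _)
        intro ω hω
        rw [hEsucc] at hω
        by_cases hω' : ω ∈ E t
        · exact Or.inr ⟨hω', fun h => hω ⟨hω', h⟩⟩
        · exact Or.inl hω'
      have h3 : a * μ (E t \ {ω | W t ω < a}) ≤ ∫⁻ ω in E t \ {ω | W t ω < a}, W t ω ∂μ := by
        rw [← setLIntegral_const]
        exact setLIntegral_mono_ae' (m2.diff m1)
          (Filter.Eventually.of_forall fun ω hω => not_lt.1 hω.2)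
      calc a * μ (E (t + 1))ᶜ + ∫⁻ ω in E (t + 1), W (t + 1) ω ∂μ
          ≤ a * (μ (E t)ᶜ + μ (E t \ {ω | W t ω < a})) + ∫⁻ ω in E (t + 1), W t ω ∂μ := by
            gcongr
        _ ≤ a * μ (E t)ᶜ + (∫⁻ ω in E t ∩ {ω | W t ω < a}, W t ω ∂μ
              + ∫⁻ ω in E t \ {ω | W t ω < a}, W t ω ∂μ) := by
            rw [mul_add, hEsucc, add_assoc, add_comm (a * μ (E t \ _))]
            gcongr
        _ = a * μ (E t)ᶜ + ∫⁻ ω in E t, W t ω ∂μ := by rw [lintegral_inter_add_sdiff _ _ m1]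
        _ ≤ _ := ih
  have hU : {ω | ∃ t, a ≤ W t ω} = ⋃ t, (E t)ᶜ := by
    ext ω
    simp only [hE, Set.mem_ofPred_eq, Set.mem_iUnion, Set.mem_compl_iff, not_forall, not_lt]
    constructor
    · rintro ⟨t, ht⟩; exact ⟨t + 1, t, t.lt_succ_self, ht⟩
    · rintro ⟨t, l, _, hl⟩; exact ⟨l, hl⟩
  have mono : Monotone fun t => (E t)ᶜ := fun s t hst ω hω hω' =>
    hω fun l hl => hω' l (hl.trans_le hst)
  rw [hU, mono.measure_iUnion, ENNReal.mul_iSup]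
  exact iSup_le fun t => le_self_add.trans (claim t)

/-- Since `(n + 2)! ≥ 2 * 3 ^ n`, the exponential series beyond the linear term is dominated by a
geometric series of ratio `x / 3`. -/
theorem exp_le_one_add_add_sq_of_nonneg {x : ℝ} (h0 : 0 ≤ x) (h3 : x < 3) :
    Real.exp x ≤ 1 + x + x ^ 2 / (2 * (1 - x / 3)) := by
  have h1 : HasSum (fun n : ℕ => x ^ n / n.factorial) (Real.exp x) := by
    rw [Real.exp_eq_exp_ℝ]; exact NormedSpace.expSeries_div_hasSum_exp x
  have h2 : HasSum (fun n : ℕ => x ^ 2 / 2 * (x / 3) ^ n) (x ^ 2 / 2 * (1 - x / 3)⁻¹) :=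
    (hasSum_geometric_of_lt_one (by positivity) (by linarith)).mul_left _
  have h4 := (hasSum_nat_add_iff' 2).2 h1
  have h5 : ∀ n : ℕ, x ^ (n + 2) / (n + 2).factorial ≤ x ^ 2 / 2 * (x / 3) ^ n := by
    intro n
    have hf : 2 * 3 ^ n ≤ (n + 2).factorial := by
      have := @Nat.factorial_mul_pow_le_factorial 2 n
      simpa [add_comm] using this
    have hf' : (2 * 3 ^ n : ℝ) ≤ (n + 2).factorial := by exact_mod_cast hf
    calc x ^ (n + 2) / (n + 2).factorial ≤ x ^ (n + 2) / (2 * 3 ^ n) := by gcongr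
      _ = _ := by rw [div_pow]; field_simp; ring
  have h6 := hasSum_le h5 h4 h2
  have h7 : (1 - x / 3) ≠ 0 := by linarith
  simp [Finset.sum_range_succ] at h6
  calc Real.exp x ≤ 1 + x + x ^ 2 / 2 * (1 - x / 3)⁻¹ := by linarith
    _ = _ := by field_simp

theorem exp_le_one_add_add_sq {x u : ℝ} (hu : |x| ≤ u) (h3 : u < 3) :
    Real.exp x ≤ 1 + x + x ^ 2 / (2 * (1 - u / 3)) := by
  have hu0 : 0 ≤ u := (abs_nonneg x).trans hu
  rcases le_total 0 x with h | h
  · have hx : x ≤ u := (le_abs_self x).trans hu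
    refine (exp_le_one_add_add_sq_of_nonneg h (hx.trans_lt h3)).trans ?_
    gcongr
    linarith
  -- For negative `x`, bound `exp (-x)` from below and use `(1 + x + x² / 2) (1 - x + x² / 2) = 1 +
  -- x⁴ / 4 ≥ 1`.
  · have h1 := Real.quadratic_le_exp_of_nonneg (x := -x) (by linarith)
    have h2 : Real.exp x ≤ 1 + x + x ^ 2 / 2 := by
      have e : Real.exp x * Real.exp (-x) = 1 := by rw [← Real.exp_add]; simp
      have p := Real.exp_pos x
      have q : 0 ≤ 1 + x + x ^ 2 / 2 := by nlinarith [sq_nonneg (x + 1)]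
      nlinarith [mul_le_mul_of_nonneg_left h1 q, mul_le_mul_of_nonneg_left h1 p.le, sq_nonneg (x^2)]
    refine h2.trans ?_
    gcongr <;> linarith

/-- The exponential moment of a centred, importance-weighted reward. -/
theorem mgf_importance_weighted_le {ρ y θ ε : ℝ} (h0 : 0 < ρ) (h1 : ρ ≤ 1) (hy0 : 0 ≤ y)
    (hy1 : y ≤ 1) (hθ : 0 ≤ θ) (hθ' : θ < 3 * ρ) (hε : |ε| ≤ 1) :
    ρ * Real.exp (ε * θ * (y / ρ - y)) + (1 - ρ) * Real.exp (ε * θ * (0 - y))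
      ≤ Real.exp (θ ^ 2 / ρ / (2 * (1 - θ / (3 * ρ)))) := by
  have hu : θ / ρ < 3 := by rw [div_lt_iff₀ h0]; exact hθ'
  have hb : ∀ z : ℝ, |z| ≤ 1 / ρ → |ε * θ * z| ≤ θ / ρ := by
    intro z hz
    rw [abs_mul, abs_mul, abs_of_nonneg hθ]
    calc |ε| * θ * |z| ≤ 1 * θ * (1 / ρ) := by gcongr
      _ = θ / ρ := by ring
  have hρ1 : 1 ≤ 1 / ρ := by rw [le_div_iff₀ h0]; linarith
  have hyρ : y ≤ y / ρ := le_div_self hy0 h0 h1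
  have b1 : |y / ρ - y| ≤ 1 / ρ := by
    rw [abs_of_nonneg (by linarith)]
    have : y / ρ ≤ 1 / ρ := by gcongr
    linarith
  have b2 : |0 - y| ≤ 1 / ρ := by
    rw [zero_sub, abs_neg, abs_of_nonneg hy0]; linarith
  have e1 := exp_le_one_add_add_sq (hb _ b1) hu
  have e2 := exp_le_one_add_add_sq (hb _ b2) hu
  have hpos : 0 < 1 - θ / ρ / 3 := by linarith
  have hε2 : ε ^ 2 ≤ 1 := (sq_le_one_iff_abs_le_one ε).2 hε
  -- The linear terms cancel because the error is centred; its variance is `y² (1 - ρ) / ρ ≤ 1 / ρ`.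
  calc _ ≤ ρ * (1 + ε * θ * (y / ρ - y) + (ε * θ * (y / ρ - y)) ^ 2 / (2 * (1 - θ / ρ / 3)))
      + (1 - ρ) * (1 + ε * θ * (0 - y) + (ε * θ * (0 - y)) ^ 2 / (2 * (1 - θ / ρ / 3))) := by
        have : 0 ≤ 1 - ρ := by linarith
        gcongr
    _ = ε ^ 2 * (y ^ 2 * (1 - ρ)) * (θ ^ 2 / ρ / (2 * (1 - θ / ρ / 3))) + 1 := by
        field_simp; ring
    _ ≤ 1 * (θ ^ 2 / ρ / (2 * (1 - θ / ρ / 3))) + 1 := by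
        have : y ^ 2 * (1 - ρ) ≤ 1 := by nlinarith
        have : 0 ≤ y ^ 2 * (1 - ρ) := mul_nonneg (sq_nonneg _) (by linarith)
        gcongr
        nlinarith [sq_nonneg ε]
    _ ≤ Real.exp (θ ^ 2 / ρ / (2 * (1 - θ / ρ / 3))) := by
        rw [one_mul]; exact Real.add_one_le_exp _
    _ = _ := by rw [div_div θ, mul_comm ρ]

/-- If `H` has conditional probability `p` given `G`, on `D`, then `H` is independent of all
`G`-measurable functions, on `D`. -/
theorem setLIntegral_inter_eq_mul {Ω : Type*} {G mΩ : MeasurableSpace Ω} {μ : Measure Ω}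
    (hG : G ≤ mΩ) {H D : Set Ω} {p : ENNReal} (hD : MeasurableSet[G] D) (h : ∀ s, MeasurableSet[G] s → s ⊆ D → μ (s ∩ H) = p * μ s)
    {f : Ω → ENNReal} (hf : Measurable[G] f) :
    ∫⁻ ω in D ∩ H, f ω ∂μ = p * ∫⁻ ω in D, f ω ∂μ := by
  rw [← lintegral_trim hG hf, ← lintegral_trim hG hf, ← smul_eq_mul, ← lintegral_smul_measure]
  congr 1
  refine @Measure.ext _ G _ _ fun s hs => ?_
  rw [trim_measurableSet_eq hG hs, Measure.smul_apply, trim_measurableSet_eq hG hs,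
    Measure.restrict_apply (hG _ hs), Measure.restrict_apply (hG _ hs), ← Set.inter_assoc,
    h _ (hs.inter hD) Set.inter_subset_right, smul_eq_mul]

/-! ### The exponential supermartingale of the estimation errors. -/

section StableRun

variable {X A K Ω : Type} [MeasurableSpace X] [MeasurableSpace A] [MeasurableSpace K]
  [mΩ : MeasurableSpace Ω] {B : Environment X A} {L : Learner X (A ⊕ K)} {ρ : ℝ} {μ : Measure Ω}

/-- The error of the importance-weighted estimate of the reward of the learner in round `t`. -/
noncomputable def StableRun.err (run : StableRun B L ρ μ) (t : ℕ) (ω : Ω) : ℝ :=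
  (if run.b t ω then run.r t ω (run.act t ω) / ρ else 0) - run.r t ω (run.act t ω)

theorem StableRun.GAct_le (run : StableRun B L ρ μ) (t : ℕ) : run.GAct t ≤ run.F (t + 1) :=
  sup_le (run.env.G_le_F_succ t) (run.measurable_act t).comap_le

theorem StableRun.F_le_GAct (run : StableRun B L ρ μ) (t : ℕ) : run.F t ≤ run.GAct t :=
  (run.env.F_le_G t).trans le_sup_left

theorem StableRun.monotone_F (run : StableRun B L ρ μ) : Monotone run.F :=
  monotone_nat_of_le_succ fun t => (run.F_le_GAct t).trans (run.GAct_le t)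

theorem StableRun.measurable_received [Countable A] [Countable K]
    [MeasurableSingletonClass (A ⊕ K)] (run : StableRun B L ρ μ) (t : ℕ) :
    Measurable[run.GAct t] fun ω => run.r t ω (run.act t ω) := by
  have h1 : Measurable fun p : (A ⊕ K → ℝ) × (A ⊕ K) => p.1 p.2 :=
    measurable_from_prod_countable_left fun a => measurable_pi_apply a
  have h2 : Measurable[run.GAct t] (run.r t) := (run.measurable_reward t).mono le_sup_left le_rfl
  have h3 : Measurable[run.GAct t] (run.act t) :=
    (comap_measurable (run.act t)).mono le_sup_right le_rfl
  exact h1.comp (h2.prodMk h3)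

theorem StableRun.measurable_err [Countable A] [Countable K]
    [MeasurableSingletonClass (A ⊕ K)] (run : StableRun B L ρ μ) (t : ℕ) :
    Measurable[run.F (t + 1)] (run.err t) := by
  have h1 := (run.measurable_received t).mono (run.GAct_le t) le_rfl
  exact (Measurable.ite (run.measurable_b t (measurableSet_singleton true)) (h1.div_const ρ)
    measurable_const).sub h1

theorem StableRun.measure_inter_b [Countable A] [Countable K] [MeasurableSingletonClass (A ⊕ K)]
    [IsProbabilityMeasure μ] (run : StableRun B L ρ μ) (h0 : 0 ≤ ρ) (t : ℕ) {s : Set Ω}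
    (hs : MeasurableSet[run.GAct t] s) (hsD : s ⊆ run.active t) :
    μ (s ∩ run.b t ⁻¹' {true}) = ENNReal.ofReal ρ * μ s := by
  have hle : run.GAct t ≤ mΩ := (run.GAct_le t).trans (run.env.F_le _)
  have mb : MeasurableSet (run.b t ⁻¹' {true}) :=
    run.env.F_le _ _ (run.measurable_b t (measurableSet_singleton true))
  have i : Integrable ((run.b t ⁻¹' {true}).indicator fun _ => (1 : ℝ)) μ :=
    (integrable_const 1).indicator mb
  have h1 := setIntegral_condExp hle i hs
  rw [setIntegral_indicator mb, setIntegral_const, smul_eq_mul, mul_one,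
    setIntegral_congr_ae (g := fun _ => ρ) (hle _ hs)
      ((run.condExp_b t).mono fun ω h hω => h (hsD hω)), setIntegral_const, smul_eq_mul] at h1
  rw [← ofReal_measureReal (s := s ∩ _), ← h1, mul_comm, ENNReal.ofReal_mul h0, ofReal_measureReal]

theorem StableRun.measure_inter_not_b [Countable A] [Countable K]
    [MeasurableSingletonClass (A ⊕ K)] [IsProbabilityMeasure μ] (run : StableRun B L ρ μ)
    (h0 : 0 ≤ ρ) (t : ℕ) {s : Set Ω} (hs : MeasurableSet[run.GAct t] s)
    (hsD : s ⊆ run.active t) :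
    μ (s ∩ run.b t ⁻¹' {false}) = ENNReal.ofReal (1 - ρ) * μ s := by
  have mb : MeasurableSet (run.b t ⁻¹' {true}) :=
    run.env.F_le _ _ (run.measurable_b t (measurableSet_singleton true))
  have e : s ∩ run.b t ⁻¹' {false} = s \ run.b t ⁻¹' {true} := by ext ω; simp
  have h1 := measure_inter_add_sdiff (μ := μ) s mb
  rw [run.measure_inter_b h0 t hs hsD] at h1
  have h2 : ENNReal.ofReal ρ * μ s ≠ ⊤ := ENNReal.mul_ne_top ENNReal.ofReal_ne_top (measure_ne_top _ _)
  rw [e, ENNReal.ofReal_sub _ h0, ENNReal.ofReal_one, ENNReal.sub_mul fun _ _ => measure_ne_top _ _,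
    one_mul]
  exact ENNReal.eq_sub_of_add_eq h2 (by rw [add_comm]; exact h1)

/-- The supermartingale that controls the errors in the active rounds. -/
noncomputable def StableRun.expErr (run : StableRun B L ρ μ) (ε θ ψ : ℝ) (t : ℕ) (ω : Ω) : ENNReal :=
  ENNReal.ofReal (Real.exp (∑ l ∈ Finset.range t,
    (run.active l).indicator (fun ω => ε * θ * run.err l ω - ψ) ω))

theorem StableRun.measurable_expErr [Countable A] [Countable K]
    [MeasurableSingletonClass (A ⊕ K)] (run : StableRun B L ρ μ) (ε θ ψ : ℝ) (t : ℕ) :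
    Measurable[run.F t] (run.expErr ε θ ψ t) := by
  refine ENNReal.measurable_ofReal.comp (Real.measurable_exp.comp ?_)
  refine Finset.measurable_sum _ fun l hl => ?_
  have hl := Finset.mem_range.1 hl
  refine Measurable.indicator ?_ (run.monotone_F hl.le _ (run.measurableSet_active l))
  exact (((run.measurable_err l).mono (run.monotone_F hl) le_rfl).const_mul _).sub_const _

/-- In an inactive round nothing changes. In an active round the received reward is known given
`GAct`, only the coin is random, and `ψ` compensates exactly the bound of
`mgf_importance_weighted_le`. -/
theorem StableRun.setLIntegral_expErr_succ_le [Countable A] [Countable K]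
    [MeasurableSingletonClass (A ⊕ K)] [IsProbabilityMeasure μ] (run : StableRun B L ρ μ)
    {ε θ : ℝ} (h0 : 0 < ρ) (h1 : ρ ≤ 1) (hθ : 0 ≤ θ) (hθ' : θ < 3 * ρ) (hε : |ε| ≤ 1)
    (t : ℕ) {s : Set Ω} (hs : MeasurableSet[run.F t] s) :
    ∫⁻ ω in s, run.expErr ε θ (θ ^ 2 / ρ / (2 * (1 - θ / (3 * ρ)))) (t + 1) ω ∂μ
      ≤ ∫⁻ ω in s, run.expErr ε θ (θ ^ 2 / ρ / (2 * (1 - θ / (3 * ρ)))) t ω ∂μ := by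
  set ψ := θ ^ 2 / ρ / (2 * (1 - θ / (3 * ρ))) with hψ
  have hle : run.GAct t ≤ mΩ := (run.GAct_le t).trans (run.env.F_le _)
  have mD := run.measurableSet_active t
  set D := run.active t with hD
  have mD' : MeasurableSet D := run.env.F_le t _ mD
  have ms : MeasurableSet s := run.env.F_le t _ hs
  have mb : MeasurableSet (run.b t ⁻¹' {true}) :=
    run.env.F_le _ _ (run.measurable_b t (measurableSet_singleton true))
  have msD : MeasurableSet[run.GAct t] (s ∩ D) := run.F_le_GAct t _ (hs.inter mD)
  set y : Ω → ℝ := fun ω => run.r t ω (run.act t ω) with hy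
  have my : Measurable[run.GAct t] y := run.measurable_received t
  have mW : Measurable[run.GAct t] (run.expErr ε θ ψ t) :=
    (run.measurable_expErr ε θ ψ t).mono (run.F_le_GAct t) le_rfl
  rw [← lintegral_inter_add_sdiff _ _ mD', ← lintegral_inter_add_sdiff (run.expErr ε θ ψ t) _ mD']
  refine add_le_add ?_ (le_of_eq ?_)
  · rw [← lintegral_inter_add_sdiff _ _ mb]
    have e : (s ∩ D) \ run.b t ⁻¹' {true} = s ∩ D ∩ run.b t ⁻¹' {false} := by
      ext ω; simp
    rw [e]
    have g : ∀ z : ℝ → ℝ, Measurable z → Measurable[run.GAct t] fun ω =>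
        run.expErr ε θ ψ t ω * ENNReal.ofReal (Real.exp (ε * θ * (z (y ω) - y ω) - ψ)) := by
      intro z hz
      refine mW.mul (ENNReal.measurable_ofReal.comp (Real.measurable_exp.comp ?_))
      exact (((hz.comp my).sub my).const_mul _).sub_const _
    have step : ∀ ω ∈ D, run.expErr ε θ ψ (t + 1) ω
        = run.expErr ε θ ψ t ω * ENNReal.ofReal (Real.exp (ε * θ * run.err t ω - ψ)) := by
      intro ω hω
      rw [StableRun.expErr, Finset.sum_range_succ, Real.exp_add,
        ENNReal.ofReal_mul (Real.exp_pos _).le, Set.indicator_of_mem hω, ← StableRun.expErr]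
    have i1 : ∫⁻ ω in s ∩ D ∩ run.b t ⁻¹' {true}, run.expErr ε θ ψ (t + 1) ω ∂μ
        = ENNReal.ofReal ρ * ∫⁻ ω in s ∩ D, run.expErr ε θ ψ t ω *
          ENNReal.ofReal (Real.exp (ε * θ * (y ω / ρ - y ω) - ψ)) ∂μ := by
      rw [← setLIntegral_inter_eq_mul hle msD (fun u hu huD =>
        run.measure_inter_b h0.le t hu (huD.trans Set.inter_subset_right))
        (g (fun y => y / ρ) (measurable_id.div_const ρ))]
      refine setLIntegral_congr_fun (((ms.inter mD').inter mb)) fun ω hω => ?_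
      have hb : run.b t ω = true := hω.2
      simp only [step ω hω.1.2, StableRun.err, hb, if_true, hy]
    have i2 : ∫⁻ ω in s ∩ D ∩ run.b t ⁻¹' {false}, run.expErr ε θ ψ (t + 1) ω ∂μ
        = ENNReal.ofReal (1 - ρ) * ∫⁻ ω in s ∩ D, run.expErr ε θ ψ t ω *
          ENNReal.ofReal (Real.exp (ε * θ * (0 - y ω) - ψ)) ∂μ := by
      rw [← setLIntegral_inter_eq_mul hle msD (fun u hu huD =>
        run.measure_inter_not_b h0.le t hu (huD.trans Set.inter_subset_right))
        (g (fun _ => 0) measurable_const)]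
      refine setLIntegral_congr_fun (e ▸ (ms.inter mD').diff mb) fun ω hω => ?_
      have hb : run.b t ω = false := hω.2
      simp [step ω hω.1.2, StableRun.err, hb, hy]
    rw [i1, i2, ← lintegral_const_mul _ ((g (fun y => y / ρ) (measurable_id.div_const ρ)).mono hle le_rfl),
      ← lintegral_const_mul _ ((g (fun _ => 0) measurable_const).mono hle le_rfl),
      ← lintegral_add_left (((g (fun y => y / ρ) (measurable_id.div_const ρ)).mono hle le_rfl).const_mul _)]
    refine lintegral_mono fun ω => ?_
    have hm := mgf_importance_weighted_le h0 h1 (run.reward_mem t ω (run.act t ω)).1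
      (run.reward_mem t ω (run.act t ω)).2 hθ hθ' hε
    rw [← hψ] at hm
    have hm' : ρ * Real.exp (ε * θ * (y ω / ρ - y ω) - ψ)
        + (1 - ρ) * Real.exp (ε * θ * (0 - y ω) - ψ) ≤ 1 := by
      rw [Real.exp_sub, Real.exp_sub, ← mul_div_assoc, ← mul_div_assoc, ← add_div]
      exact div_le_one_of_le₀ hm (Real.exp_pos _).le
    have h1' : 0 ≤ 1 - ρ := by linarith
    calc _ = run.expErr ε θ ψ t ω * ENNReal.ofReal (ρ * Real.exp (ε * θ * (y ω / ρ - y ω) - ψ)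
        + (1 - ρ) * Real.exp (ε * θ * (0 - y ω) - ψ)) := by
          rw [ENNReal.ofReal_add (by positivity) (by positivity), ENNReal.ofReal_mul h0.le,
            ENNReal.ofReal_mul h1']
          ring
      _ ≤ run.expErr ε θ ψ t ω * 1 := by
          gcongr
          exact ENNReal.ofReal_le_one.2 hm'
      _ = _ := mul_one _
  · refine setLIntegral_congr_fun (ms.diff mD') fun ω hω => ?_
    simp only [StableRun.expErr]
    rw [Finset.sum_range_succ, Set.indicator_of_notMem hω.2, add_zero]

/-- In the active rounds the errors obey a line-crossing inequality. -/
theorem StableRun.measure_exists_le_sum_err [Countable A] [Countable K]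
    [MeasurableSingletonClass (A ⊕ K)] [IsProbabilityMeasure μ] (run : StableRun B L ρ μ)
    {ε θ : ℝ} (h0 : 0 < ρ) (h1 : ρ ≤ 1) (hθ : 0 ≤ θ) (hθ' : θ < 3 * ρ) (hε : |ε| ≤ 1) (q : ℝ) :
    μ {ω | ∃ t, q ≤ ∑ l ∈ Finset.range t, (run.active l).indicator
        (fun ω => ε * θ * run.err l ω - θ ^ 2 / ρ / (2 * (1 - θ / (3 * ρ)))) ω}
      ≤ ENNReal.ofReal (Real.exp (-q)) := by
  have h := mul_measure_exists_le_le_lintegral run.monotone_F run.env.F_le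
    (run.measurable_expErr ε θ (θ ^ 2 / ρ / (2 * (1 - θ / (3 * ρ)))))
    (fun t s hs => run.setLIntegral_expErr_succ_le h0 h1 hθ hθ' hε t hs)
    (ENNReal.ofReal (Real.exp q))
  have e : ∫⁻ ω, run.expErr ε θ (θ ^ 2 / ρ / (2 * (1 - θ / (3 * ρ)))) 0 ω ∂μ = 1 := by
    simp [StableRun.expErr]
  rw [e] at h
  have h2 : {ω | ∃ t, ENNReal.ofReal (Real.exp q)
      ≤ run.expErr ε θ (θ ^ 2 / ρ / (2 * (1 - θ / (3 * ρ)))) t ω}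
      = {ω | ∃ t, q ≤ ∑ l ∈ Finset.range t, (run.active l).indicator
        (fun ω => ε * θ * run.err l ω - θ ^ 2 / ρ / (2 * (1 - θ / (3 * ρ)))) ω} := by
    ext ω
    simp only [Set.mem_ofPred_eq, StableRun.expErr,
      ENNReal.ofReal_le_ofReal_iff (Real.exp_pos _).le, Real.exp_le_exp]
  rw [h2] at h
  rw [Real.exp_neg, ENNReal.ofReal_inv_of_pos (Real.exp_pos _)]
  rwa [← one_div, ENNReal.le_div_iff_mul_le, mul_comm]
  · exact Or.inl (by simp [Real.exp_pos])
  · exact Or.inl ENNReal.ofReal_ne_top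

end StableRun

/-! ### Confidence sequences by stitching -/

/-- The tuning `φ` would be optimal at `n = 1.4 * N`, close to the geometric mean of `N` and `2 *
N`. Over the whole range the loss raises the optimal constant `√2` to at most 1.44; after squaring,
`(n - N) (2 N - n) ≥ 0` suffices. -/
theorem stitching_bound {N n q ρ φ : ℝ} (hN : 0 < N) (hn : N ≤ n) (hn' : n ≤ 2 * N) (hq : 0 < q)
    (hρ : 0 < ρ) (hφ : 0 < φ) (hφ2 : φ ^ 2 = 2 * q * ρ / (1.4 * N)) :
    q / φ + n * φ / (2 * ρ) ≤ 1.44 * √(n / ρ * q) := by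
  have hn0 : 0 < n := hN.trans_le hn
  have e : (1.44 : ℝ) * √(n / ρ * q) = √(1.44 ^ 2 * (n / ρ * q)) := by
    rw [Real.sqrt_mul (by norm_num : (0 : ℝ) ≤ 1.44 ^ 2), Real.sqrt_sq (by norm_num)]
  rw [e]
  apply Real.le_sqrt_of_sq_le
  have h1 : (q / φ + n * φ / (2 * ρ)) ^ 2
      = q ^ 2 / φ ^ 2 + q * n / ρ + n ^ 2 * φ ^ 2 / (4 * ρ ^ 2) := by
    field_simp; ring
  have h2 : (q / φ + n * φ / (2 * ρ)) ^ 2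
      = (1.96 * N ^ 2 + 2.8 * N * n + n ^ 2) * (q / (2.8 * N * ρ)) := by
    rw [h1, hφ2]; field_simp; ring
  have h3 : 1.44 ^ 2 * (n / ρ * q) = 1.44 ^ 2 * (2.8 * N * n) * (q / (2.8 * N * ρ)) := by
    field_simp
  rw [h2, h3]
  refine mul_le_mul_of_nonneg_right ?_ (by positivity)
  nlinarith [mul_nonneg (sub_nonneg.2 hn) (sub_nonneg.2 hn')]

/-- Because `4 > e`, the iterated logarithm in the confidence level is positive from the first round
on. -/
theorem log_four_mul_ge {x : ℝ} (hx : 1 ≤ x) : 1 < Real.log (4 * x) := by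
  have h1 : Real.log 4 = 2 * Real.log 2 := by
    rw [show (4 : ℝ) = 2 ^ 2 by norm_num, Real.log_pow]; norm_num
  have h2 : Real.log 4 ≤ Real.log (4 * x) := Real.log_le_log (by norm_num) (by linarith)
  have := Real.log_two_gt_d9
  linarith

/-- The logarithmic factor `λ` of the confidence width, after `n` rounds. -/
noncomputable def confLevel (δ n : ℝ) : ℝ :=
  1.4 * Real.log (Real.log (4 * n)) + Real.log (5.2 / δ)

theorem confLevel_mono {δ m n : ℝ} (hm : 1 ≤ m) (hmn : m ≤ n) :
    confLevel δ m ≤ confLevel δ n := by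
  have h := log_four_mul_ge hm
  unfold confLevel
  have := Real.log_le_log (by linarith) (Real.log_le_log (x := 4 * m) (by linarith) (by linarith :
    4 * m ≤ 4 * n))
  linarith

theorem confLevel_pos {δ n : ℝ} (h0 : 0 < δ) (h1 : δ < 1) (hn : 1 ≤ n) : 0 < confLevel δ n := by
  have h := Real.log_pos (log_four_mul_ge hn)
  have : 0 < Real.log (5.2 / δ) := Real.log_pos (by rw [lt_div_iff₀ h0]; linarith)
  unfold confLevel; linarith

theorem exp_neg_confLevel {δ n : ℝ} (h0 : 0 < δ) (hn : 1 ≤ n) :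
    Real.exp (-confLevel δ n) = δ * (Real.log (4 * n) ^ (-1.4 : ℝ) / 5.2) := by
  have h := log_four_mul_ge hn
  rw [confLevel, neg_add, Real.exp_add, Real.exp_neg (Real.log _), Real.exp_log (by positivity),
    Real.rpow_def_of_pos (by linarith)]
  rw [show -(1.4 * Real.log (Real.log (4 * n))) = Real.log (Real.log (4 * n)) * -1.4 by ring]
  field_simp

/-- As `log (4 * 2 ^ k) = (k + 2) log 2`, this is a shifted p-series with exponent `1.4 > 1`. -/
theorem summable_log_pow_two_rpow :
    Summable fun k : ℕ => Real.log (4 * 2 ^ k) ^ (-1.4 : ℝ) / 5.2 := by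
  have e : ∀ k : ℕ, Real.log (4 * 2 ^ k) ^ (-1.4 : ℝ) / 5.2
      = (Real.log 2 ^ (-1.4 : ℝ) / 5.2) * ((k + 2 : ℕ) : ℝ) ^ (-1.4 : ℝ) := by
    intro k
    have : Real.log (4 * 2 ^ k) = (k + 2 : ℕ) * Real.log 2 := by
      rw [← Real.log_pow]; congr 1; ring
    rw [this, Real.mul_rpow (by positivity) (Real.log_nonneg (by norm_num))]
    ring
  simp_rw [e]
  refine Summable.mul_left _ ?_
  exact (summable_nat_add_iff 2).2 (Real.summable_nat_rpow.2 (by norm_num))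

section StableRun

variable {X A K Ω : Type} [MeasurableSpace X] [MeasurableSpace A] [MeasurableSpace K]
  [mΩ : MeasurableSpace Ω] {B : Environment X A} {L : Learner X (A ⊕ K)} {ρ : ℝ} {μ : Measure Ω}

theorem StableRun.sum_range_indicator_active (run : StableRun B L ρ μ) {ω : Ω} {t₀ t : ℕ}
    (h0 : run.start ω = t₀) (hlt : t₀ ≤ t) (ht : (t : ℕ∞) ≤ run.finish ω) (f : ℕ → Ω → ℝ) :
    ∑ l ∈ Finset.range t, (run.active l).indicator (f l) ω = ∑ l ∈ Finset.Ico t₀ t, f l ω := by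
  rw [Finset.range_eq_Ico, ← Finset.sum_Ico_consecutive _ (Nat.zero_le t₀) hlt,
    Finset.sum_eq_zero, zero_add]
  · refine Finset.sum_congr rfl fun l hl => Set.indicator_of_mem (s := run.active l) ?_ _
    rw [Finset.mem_Ico] at hl
    exact ⟨by rw [h0]; exact_mod_cast hl.1, lt_of_lt_of_le (by exact_mod_cast hl.2) ht⟩
  · intro l hl
    rw [Finset.mem_Ico] at hl
    refine Set.indicator_of_notMem (s := run.active l) (fun h => ?_) _
    have := h.1
    rw [h0] at this
    have : t₀ ≤ l := by exact_mod_cast this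
    omega

/-- The error estimate, with error probability `exp (- λ)`, for epochs of `N` to `2 * N` rounds. -/
theorem StableRun.measure_exists_epoch_err_gt [Countable A] [Countable K]
    [MeasurableSingletonClass (A ⊕ K)] [IsProbabilityMeasure μ] (run : StableRun B L ρ μ)
    {ε δ : ℝ} {N : ℕ} (hρ : 0 < ρ) (hρ1 : ρ ≤ 1) (hε : |ε| ≤ 1) (h0 : 0 < δ) (h1 : δ < 1)
    (hN : 1 ≤ N) :
    μ {ω | ∃ t₀ t : ℕ, run.start ω = t₀ ∧ t₀ ≤ t ∧ (t : ℕ∞) ≤ run.finish ω ∧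
        N ≤ t - t₀ ∧ t - t₀ ≤ 2 * N ∧
        confWidth δ ρ (t - t₀) < ε * ∑ l ∈ Finset.Ico t₀ t, run.err l ω}
      ≤ ENNReal.ofReal (Real.exp (-confLevel δ N)) := by
  have hN' : (1 : ℝ) ≤ N := by exact_mod_cast hN
  have hN0 : (0 : ℝ) < N := by linarith
  set q := confLevel δ N with hq
  have hq0 : 0 < q := confLevel_pos h0 h1 hN'
  set φ := √(2 * q * ρ / (1.4 * N)) with hφ
  have hφ0 : 0 < φ := Real.sqrt_pos.2 (by positivity)
  have hφ2 : φ ^ 2 = 2 * q * ρ / (1.4 * N) := Real.sq_sqrt (by positivity)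
  -- Chosen so that `1 / θ = 1 / φ + 1 / (3 * ρ)`: then `ψ / θ = φ / (2 * ρ)`, and the Bernstein
  -- correction separates into the single term `q / (3 * ρ)`, which `0.41 / ρ * q` covers.
  set θ := 3 * ρ * φ / (3 * ρ + φ) with hθ
  have hθ0 : 0 < θ := by positivity
  have hθ1 : θ < 3 * ρ := by
    rw [hθ, div_lt_iff₀ (by positivity)]; nlinarith [mul_pos hρ hρ]
  have hψ : θ ^ 2 / ρ / (2 * (1 - θ / (3 * ρ))) = θ * φ / (2 * ρ) := by
    have : 1 - θ / (3 * ρ) = 3 * ρ / (3 * ρ + φ) := by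
      rw [hθ]; field_simp; ring
    rw [this, hθ]; field_simp
  refine (measure_mono ?_).trans (run.measure_exists_le_sum_err hρ hρ1 hθ0.le hθ1 hε q)
  rintro ω ⟨t₀, t, hs, hle, hf, hNt, hNt', hbig⟩
  refine ⟨t, ?_⟩
  rw [run.sum_range_indicator_active hs hle hf, hψ, Finset.sum_sub_distrib, Finset.sum_const,
    Nat.card_Ico, ← Finset.mul_sum, nsmul_eq_mul]
  set n := t - t₀ with hn
  have hnN : (N : ℝ) ≤ n := by exact_mod_cast hNt
  have hnN' : (n : ℝ) ≤ 2 * N := by exact_mod_cast hNt'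
  set S := ∑ l ∈ Finset.Ico t₀ t, run.err l ω with hS
  have hb := stitching_bound hN0 hnN hnN' hq0 hρ hφ0 hφ2
  have hmono : q ≤ confLevel δ n := confLevel_mono hN' hnN
  have hw : 1.44 * √(n / ρ * q) + 0.41 / ρ * q ≤ confWidth δ ρ n := by
    have : confWidth δ ρ n = 1.44 * √(n / ρ * confLevel δ n) + 0.41 / ρ * confLevel δ n := rfl
    rw [this]; gcongr
  have h3 : q / φ + n * φ / (2 * ρ) + 0.41 / ρ * q ≤ ε * S := by linarith
  have h4 : q / (3 * ρ) ≤ 0.41 / ρ * q := by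
    rw [div_mul_eq_mul_div, div_le_div_iff₀ (by positivity) hρ]
    nlinarith [mul_pos hq0 hρ]
  have h5 : θ * (q / φ + n * φ / (2 * ρ) + q / (3 * ρ)) ≤ θ * (ε * S) := by gcongr; linarith
  have h6 : θ * (q / φ + n * φ / (2 * ρ) + q / (3 * ρ)) = q + n * (θ * φ / (2 * ρ)) := by
    rw [hθ]; field_simp; ring
  linarith

/-- The constant in the failure probability of the confidence sequences. -/
noncomputable def confConst : ℝ := ∑' k : ℕ, Real.log (4 * 2 ^ k) ^ (-1.4 : ℝ) / 5.2

theorem confConst_nonneg : 0 ≤ confConst := tsum_nonneg fun k => by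
  have := log_four_mul_ge (one_le_pow₀ (n := k) (by norm_num : (1 : ℝ) ≤ 2))
  have : 0 ≤ Real.log (4 * 2 ^ k) := by linarith
  positivity

/-- Stitching: lengths are grouped between consecutive powers of two, and the failure probabilities
of the groups are summed. -/
theorem StableRun.measure_exists_err_gt [Countable A] [Countable K]
    [MeasurableSingletonClass (A ⊕ K)] [IsProbabilityMeasure μ] (run : StableRun B L ρ μ)
    {ε δ : ℝ} (hρ : 0 < ρ) (hρ1 : ρ ≤ 1) (hε : |ε| ≤ 1) (h0 : 0 < δ) (h1 : δ < 1) :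
    μ {ω | ∃ t₀ t : ℕ, run.start ω = t₀ ∧ t₀ < t ∧ (t : ℕ∞) ≤ run.finish ω ∧
        confWidth δ ρ (t - t₀) < ε * ∑ l ∈ Finset.Ico t₀ t, run.err l ω}
      ≤ ENNReal.ofReal (δ * confConst) := by
  calc _ ≤ μ (⋃ k : ℕ, {ω | ∃ t₀ t : ℕ, run.start ω = t₀ ∧ t₀ ≤ t ∧ (t : ℕ∞) ≤ run.finish ω ∧
        2 ^ k ≤ t - t₀ ∧ t - t₀ ≤ 2 * 2 ^ k ∧
        confWidth δ ρ (t - t₀) < ε * ∑ l ∈ Finset.Ico t₀ t, run.err l ω}) := by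
        refine measure_mono ?_
        rintro ω ⟨t₀, t, hs, hlt, hf, hbig⟩
        refine Set.mem_iUnion.2 ⟨Nat.log 2 (t - t₀), t₀, t, hs, hlt.le, hf,
          Nat.pow_log_le_self 2 (by omega), ?_, hbig⟩
        have := Nat.lt_pow_succ_log_self (b := 2) (by norm_num) (t - t₀)
        rw [pow_succ] at this; omega
    _ ≤ ∑' k : ℕ, ENNReal.ofReal (Real.exp (-confLevel δ ((2 ^ k : ℕ) : ℝ))) :=
        (measure_iUnion_le _).trans (ENNReal.tsum_le_tsum fun k =>
          run.measure_exists_epoch_err_gt hρ hρ1 hε h0 h1 Nat.one_le_two_pow)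
    _ = ENNReal.ofReal (δ * confConst) := by
        rw [confConst, ← tsum_mul_left, ENNReal.ofReal_tsum_of_nonneg]
        · refine tsum_congr fun k => ?_
          rw [exp_neg_confLevel h0 (by exact_mod_cast Nat.one_le_two_pow)]
          push_cast; rfl
        · intro k
          have := log_four_mul_ge (one_le_pow₀ (n := k) (by norm_num : (1 : ℝ) ≤ 2))
          have : 0 ≤ Real.log (4 * 2 ^ k) := by linarith
          positivity
        · exact summable_log_pow_two_rpow.mul_left _

end StableRun

/-! ### The base learners of a run -/

instance instMeasurableSingletonClassSum {α β : Type*} [MeasurableSpace α] [MeasurableSpace β]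
    [MeasurableSingletonClass α] [MeasurableSingletonClass β] :
    MeasurableSingletonClass (α ⊕ β) where
  measurableSet_singleton
    | Sum.inl a => by
      rw [← Set.image_singleton]; exact (measurableSet_singleton a).inl_image
    | Sum.inr b => by
      rw [← Set.image_singleton]; exact measurableSet_inr_image.2 (measurableSet_singleton b)

theorem resolve_eq_elim {A : Type} {M : ℕ} (act : (i : Fin M) → A ⊕ Linked i) (i : Fin M) :
    resolve act i = Sum.elim id (fun j : Linked i => resolve act j.1) (act i) := by
  rw [resolve]
  cases act i <;> rfl

/-- Resolution from `i` consults only indices from `i` on. Measurability of those proposals alone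
must suffice, since the reward of a linked action of `j` has to be known before `j` draws. -/
theorem measurable_resolve {A Ω : Type} [MeasurableSpace A] [Countable A]
    [MeasurableSingletonClass A] {M : ℕ} {m : MeasurableSpace Ω}
    {act : Ω → (i : Fin M) → A ⊕ Linked i} (i : Fin M)
    (h : ∀ j, i ≤ j → Measurable fun ω => act ω j) : Measurable fun ω => resolve (act ω) i := by
  have ih : ∀ j : Linked i, Measurable fun ω => resolve (act ω) j.1 := fun j =>
    measurable_resolve j.1 fun k hk => h k (j.2.le.trans hk)
  refine measurable_to_countable' fun a => ?_
  have e : (fun ω => resolve (act ω) i) ⁻¹' {a}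
      = (fun ω => act ω i) ⁻¹' (Sum.inl '' {a})
        ∪ ⋃ j : Linked i, (fun ω => act ω i) ⁻¹' (Sum.inr '' {j})
          ∩ (fun ω => resolve (act ω) j.1) ⁻¹' {a} := by
    ext ω
    simp only [Set.mem_preimage, resolve_eq_elim (act ω) i, Set.mem_union, Set.mem_iUnion,
      Set.mem_inter_iff]
    rcases h : act ω i with b | j
    · simp
    · simp [Subtype.ext_iff, j.2]
  rw [e]
  refine (h i le_rfl (measurableSet_inl_image.2 (measurableSet_singleton a))).union
    (MeasurableSet.iUnion fun j => ?_)
  exact (h i le_rfl (measurableSet_inr_image.2 (measurableSet_singleton j))).inter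
    (ih j (measurableSet_singleton a))
termination_by M - i.val
decreasing_by
  have _h1 : i.val < j.1.val := j.2
  have _h2 := j.1.isLt
  omega

theorem samplingProb_nonneg {M : ℕ} (R : Fin M → ℝ) (s i : Fin M) : 0 ≤ samplingProb R s i := by
  unfold samplingProb
  split_ifs <;> positivity

theorem sum_inv_sq_pos {M : ℕ} {R : Fin M → ℝ} (hR : ∀ i, 0 < R i) (s : Fin M) :
    0 < ∑ j ∈ Finset.Ici s, (R j ^ 2)⁻¹ :=
  Finset.sum_pos (fun j _ => by have := hR j; positivity) ⟨s, Finset.mem_Ici.2 le_rfl⟩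

theorem samplingProb_pos {M : ℕ} {R : Fin M → ℝ} (hR : ∀ i, 0 < R i) {s i : Fin M} (h : s ≤ i) :
    0 < samplingProb R s i := by
  have := hR i
  rw [samplingProb, if_pos h]
  exact div_pos (by positivity) (sum_inv_sq_pos hR s)

theorem sum_Ici_samplingProb {M : ℕ} {R : Fin M → ℝ} (hR : ∀ i, 0 < R i) (s : Fin M) :
    ∑ i ∈ Finset.Ici s, samplingProb R s i = 1 := by
  rw [Finset.sum_congr rfl (g := fun i => (R i ^ 2)⁻¹ / ∑ j ∈ Finset.Ici s, (R j ^ 2)⁻¹),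
    ← Finset.sum_div, div_self (sum_inv_sq_pos hR s).ne']
  intro i hi
  rw [samplingProb, if_pos (Finset.mem_Ici.1 hi)]

theorem sum_samplingProb {M : ℕ} {R : Fin M → ℝ} (hR : ∀ i, 0 < R i) (s : Fin M) :
    ∑ i, samplingProb R s i = 1 := by
  rw [← sum_Ici_samplingProb hR s]
  refine (Finset.sum_subset (Finset.subset_univ _) fun i _ hi => ?_).symm
  rw [samplingProb, if_neg (fun h => hi (Finset.mem_Ici.2 h))]

theorem samplingProb_le_one {M : ℕ} {R : Fin M → ℝ} (hR : ∀ i, 0 < R i) (s i : Fin M) :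
    samplingProb R s i ≤ 1 := by
  rw [← sum_samplingProb hR s]
  exact Finset.single_le_sum (fun j _ => samplingProb_nonneg R s j) (Finset.mem_univ i)

/-! ### Epochs as intervals between stopping times. -/

/-- The first time at which `p` holds. -/
noncomputable def firstTime (p : ℕ → Prop) : ℕ∞ := ⨅ l, ⨅ (_ : p l), (l : ℕ∞)

theorem firstTime_le_iff {p : ℕ → Prop} {t : ℕ} : firstTime p ≤ t ↔ ∃ l ≤ t, p l := by
  constructor
  · intro h
    by_contra! hp
    have : ((t + 1 : ℕ) : ℕ∞) ≤ firstTime p := le_iInf₂ fun l hl => by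
      have : t + 1 ≤ l := by by_contra hlt; exact hp l (by omega) hl
      exact_mod_cast this
    have := this.trans h
    have : t + 1 ≤ t := by exact_mod_cast this
    omega
  · rintro ⟨l, hl, hp⟩
    exact (iInf₂_le l hp).trans (by exact_mod_cast hl)

theorem firstTime_eq_iff {p : ℕ → Prop} {t : ℕ} :
    firstTime p = t ↔ p t ∧ ∀ l < t, ¬ p l := by
  constructor
  · intro h
    have hl : ∀ l < t, ¬ p l := fun l hl hp => by
      have h1 : firstTime p ≤ l := firstTime_le_iff.2 ⟨l, le_rfl, hp⟩
      rw [h] at h1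
      have : t ≤ l := by exact_mod_cast h1
      omega
    obtain ⟨l, hlt, hp⟩ := firstTime_le_iff.1 h.le
    rcases hlt.lt_or_eq with h1 | rfl
    · exact absurd hp (hl l h1)
    · exact ⟨hp, hl⟩
  · rintro ⟨hp, hl⟩
    refine le_antisymm (firstTime_le_iff.2 ⟨t, le_rfl, hp⟩) (le_iInf₂ fun l h => ?_)
    have : t ≤ l := not_lt.1 fun hlt => hl l hlt h
    exact_mod_cast this

section ArbeRun

variable {X A Ω : Type} {M : ℕ} [MeasurableSpace X] [MeasurableSpace A] [mΩ : MeasurableSpace Ω]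
  {B : Environment X A} {L : (i : Fin M) → Learner X (A ⊕ Linked i)} {R : Fin M → ℝ} {c δ : ℝ}
  {μ : Measure Ω}

/-- In every round the algorithm either goes on with the epoch or starts a new one, with a larger
smallest active index. -/
theorem ArbeRun.step (run : ArbeRun B L R c δ μ) (t : ℕ) (ω : Ω) :
    (run.s (t + 1) ω = run.s t ω ∧ run.start (t + 1) ω = run.start t ω) ∨
      (run.s t ω < run.s (t + 1) ω ∧ run.start (t + 1) ω = t + 1) := by
  by_cases h : ∃ i j, TestTriggers R c δ (fun l => run.b l ω)
        (fun l => run.r l ω (resolve (run.act l ω) (run.b l ω))) (run.s t ω) (run.start t ω)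
        (t + 1) i j
  · obtain ⟨i, j, hT, hs, hst⟩ := run.step_restart t ω h
    refine Or.inr ⟨?_, hst⟩
    have h1 : (run.s t ω : ℕ) ≤ i := hT.1
    rw [Fin.lt_def, hs]
    omega
  · exact Or.inl (run.step_continue t ω (by simpa using h))

/-- Each restart raises `s`, so every value of `s` is taken on one interval of rounds at most, and
the value of `s` identifies the epoch. -/
theorem ArbeRun.epoch (run : ArbeRun B L R c δ μ) (t : ℕ) (ω : Ω) :
    run.start t ω ≤ t ∧
      (∀ l, run.start t ω ≤ l → l ≤ t → run.s l ω = run.s t ω ∧ run.start l ω = run.start t ω) ∧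
      ∀ l < run.start t ω, run.s l ω < run.s t ω := by
  induction t with
  | zero =>
    simp only [run.start_zero]
    refine ⟨le_rfl, fun l _ hl => ?_, fun l hl => absurd hl (Nat.not_lt_zero l)⟩
    obtain rfl : l = 0 := by omega
    exact ⟨rfl, run.start_zero ω⟩
  | succ t ih =>
    obtain ⟨h1, h2, h3⟩ := ih
    rcases run.step t ω with ⟨hs, hst⟩ | ⟨hs, hst⟩
    · rw [hst]
      refine ⟨h1.trans t.le_succ, fun l hl hlt => ?_, fun l hl => by rw [hs]; exact h3 l hl⟩
      rcases Nat.le_succ_iff.1 hlt with h | rfl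
      · rw [hs]; exact h2 l hl h
      · exact ⟨rfl, hst⟩
    · rw [hst]
      refine ⟨le_rfl, fun l hl hlt => ?_, fun l hl => ?_⟩
      · obtain rfl : l = t + 1 := le_antisymm hlt hl
        exact ⟨rfl, hst⟩
      · refine lt_of_le_of_lt ?_ hs
        by_cases h : run.start t ω ≤ l
        · exact (h2 l h (by omega)).1.le
        · exact (h3 l (not_le.1 h)).le

theorem ArbeRun.monotone_s (run : ArbeRun B L R c δ μ) (ω : Ω) : Monotone fun t => run.s t ω :=
  monotone_nat_of_le_succ fun t => by
    rcases run.step t ω with h | h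
    · exact h.1.ge
    · exact h.1.le

theorem ArbeRun.monotone_F (run : ArbeRun B L R c δ μ) : Monotone run.F :=
  monotone_nat_of_le_succ fun t => (run.env.F_le_G t).trans (run.env.G_le_F_succ t)

/-- The index is strictly smaller before the epoch, so the recorded start is the first visit of `s`
to `s₀`, a stopping time. -/
theorem ArbeRun.start_eq_iff (run : ArbeRun B L R c δ μ) {t : ℕ} {ω : Ω} {s₀ : Fin M}
    (h : run.s t ω = s₀) (t₀ : ℕ) :
    firstTime (fun l => run.s l ω = s₀) = t₀ ↔ run.start t ω = t₀ := by
  obtain ⟨h1, h2, h3⟩ := run.epoch t ω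
  have : firstTime (fun l => run.s l ω = s₀) = run.start t ω := firstTime_eq_iff.2
    ⟨h ▸ (h2 _ le_rfl h1).1, fun l hl => h ▸ (h3 l hl).ne⟩
  rw [this]
  norm_cast

/-! ### The joint law of the draws in a round. -/

/-- The probability that base learner `i` makes a choice in `T` and proposes `a` in round `t`,
in an epoch with smallest active index `s₀`. -/
noncomputable def ArbeRun.drawProb (run : ArbeRun B L R c δ μ) (s₀ : Fin M) (t : ℕ) (i : Fin M)
    (T : Set (L i).Choice) (a : A ⊕ Linked i) (ω : Ω) : ℝ :=
  (L i).drawProb (samplingProb R s₀ i)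
    (history (fun l => (run.choice l ω i, run.x l ω, run.act l ω i,
      if run.b l ω = i then run.r l ω (resolve (run.act l ω) i) / samplingProb R s₀ i else 0))
      (run.start t ω) t) (run.x t ω) T a

/-- The proposals of all active base learners other than `j`. -/
def ArbeRun.others (run : ArbeRun B L R c δ μ) (s₀ j : Fin M) (t : ℕ) (ω : Ω) :
    (k : {k : Fin M // s₀ ≤ k ∧ k ≠ j}) → A ⊕ Linked k.1 := fun k => run.act t ω k.1

theorem ArbeRun.measurable_others (run : ArbeRun B L R c δ μ) (s₀ j : Fin M) (t : ℕ) :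
    Measurable[run.F (t + 1)] (run.others s₀ j t) :=
  @measurable_pi_lambda _ _ _ (run.F (t + 1)) _ _ fun k => run.measurable_act t k.1

/-- The draw rule for all learners, with the choices of the others left free and their proposals
copied from `ω₁`. -/
theorem ArbeRun.condExp_draw_inter_others (run : ArbeRun B L R c δ μ) {s₀ j : Fin M} (hj : s₀ ≤ j)
    (t : ℕ) {T : Set (L j).Choice} (hT : MeasurableSet T) (a : A ⊕ Linked j) (k : Fin M) (ω₁ : Ω) :
    ∀ᵐ ω ∂μ, run.s t ω = s₀ →
      (μ[({ω' | run.choice t ω' j ∈ T ∧ run.act t ω' j = a} ∩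
          run.others s₀ j t ⁻¹' {run.others s₀ j t ω₁} ∩ run.b t ⁻¹' {k}).indicator
          (fun _ => (1 : ℝ)) | run.G t]) ω
        = (∏ i ∈ (Finset.Ici s₀).erase j, run.drawProb s₀ t i Set.univ (run.act t ω₁ i) ω)
          * run.drawProb s₀ t j T a ω * samplingProb R s₀ k := by
  classical
  have hT' : ∀ i, MeasurableSet (Function.update (fun i => (Set.univ : Set (L i).Choice)) j T i) := by
    intro i
    by_cases h : i = j
    · subst h; simpa using hT
    · simp [h]
  have hd := run.draw t s₀ _ (Function.update (run.act t ω₁) j a) k hT'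
  have e : {ω' | (∀ i, s₀ ≤ i →
        run.choice t ω' i ∈ Function.update (fun i => (Set.univ : Set (L i).Choice)) j T i ∧
        run.act t ω' i = Function.update (run.act t ω₁) j a i) ∧ run.b t ω' = k}
      = {ω' | run.choice t ω' j ∈ T ∧ run.act t ω' j = a} ∩
          run.others s₀ j t ⁻¹' {run.others s₀ j t ω₁} ∩ run.b t ⁻¹' {k} := by
    ext ω
    simp only [Set.mem_ofPred_eq, Set.mem_inter_iff, Set.mem_preimage, Set.mem_singleton_iff,
      ArbeRun.others, funext_iff, Subtype.forall]
    refine and_congr_left fun _ => ⟨fun h => ⟨by simpa using h j hj, fun i hi => ?_⟩, fun h i hi => ?_⟩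
    · simpa [hi.2] using (h i hi.1).2
    · by_cases hij : i = j
      · subst hij; simpa using h.1
      · simpa [hij] using h.2 i ⟨hi, hij⟩
  rw [e] at hd
  filter_upwards [hd] with ω hd hs
  rw [hd hs, ← Finset.prod_erase_mul _ _ (Finset.mem_Ici.2 hj)]
  congr 2
  · refine Finset.prod_congr rfl fun i hi => ?_
    have := Finset.ne_of_mem_erase hi
    simp only [ArbeRun.drawProb, Function.update_of_ne this]
  · simp only [ArbeRun.drawProb, Function.update_self]

theorem ArbeRun.measurableSet_draw (run : ArbeRun B L R c δ μ) [Countable A]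
    [MeasurableSingletonClass A] (t : ℕ) {j : Fin M}
    {T : Set (L j).Choice} (hT : MeasurableSet T) (a : A ⊕ Linked j) :
    MeasurableSet {ω' | run.choice t ω' j ∈ T ∧ run.act t ω' j = a} :=
  run.env.F_le _ _ ((run.measurable_choice t j hT).inter
    (run.measurable_act t j (measurableSet_singleton a)))

end ArbeRun

section ArbeRun

variable {X A Ω : Type} {M : ℕ} [MeasurableSpace X] [MeasurableSpace A] [mΩ : MeasurableSpace Ω]
  {B : Environment X A} {L : (i : Fin M) → Learner X (A ⊕ Linked i)} {R : Fin M → ℝ} {c δ : ℝ}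
  {μ : Measure Ω}

theorem ArbeRun.G_le (run : ArbeRun B L R c δ μ) (t : ℕ) : run.G t ≤ mΩ :=
  (run.env.G_le_F_succ t).trans (run.env.F_le _)

variable [Countable A] [MeasurableSingletonClass A] [IsProbabilityMeasure μ]

/-- The joint conditional law of a draw of base learner `j`, the proposals of the other active
learners, and the event that `j` is followed (`β = true`) or not. -/
theorem ArbeRun.condExp_draw_inter_others_inter_decide (run : ArbeRun B L R c δ μ)
    (hR : ∀ i, 0 < R i) {s₀ j : Fin M} (hj : s₀ ≤ j) (t : ℕ) {T : Set (L j).Choice}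
    (hT : MeasurableSet T) (a : A ⊕ Linked j) (β : Bool) (ω₁ : Ω) :
    ∀ᵐ ω ∂μ, run.s t ω = s₀ →
      (μ[({ω' | run.choice t ω' j ∈ T ∧ run.act t ω' j = a ∧ decide (run.b t ω' = j) = β} ∩
          run.others s₀ j t ⁻¹' {run.others s₀ j t ω₁}).indicator (fun _ => (1 : ℝ)) | run.G t]) ω
        = (∏ i ∈ (Finset.Ici s₀).erase j, run.drawProb s₀ t i Set.univ (run.act t ω₁ i) ω)
          * (run.drawProb s₀ t j T a ω *
            (if β then samplingProb R s₀ j else 1 - samplingProb R s₀ j)) := by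
  have mb : Measurable (run.b t) := (run.measurable_b t).mono (run.env.F_le _) le_rfl
  have mo : MeasurableSet (run.others s₀ j t ⁻¹' {run.others s₀ j t ω₁}) :=
    run.env.F_le _ _ (run.measurable_others s₀ j t (measurableSet_singleton _))
  set O := run.others s₀ j t ⁻¹' {run.others s₀ j t ω₁} with hO
  set H := {ω' | run.choice t ω' j ∈ T ∧ run.act t ω' j = a} with hH
  have mH : MeasurableSet H := run.measurableSet_draw t hT a
  set H' := {ω' | run.choice t ω' j ∈ T ∧ run.act t ω' j = a ∧ decide (run.b t ω' = j) = β}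
    with hH'
  have eH' : H' = H ∩ run.b t ⁻¹' {k | decide (k = j) = β} := by
    ext ω; simp [hH', hH, and_assoc]
  have mH' : MeasurableSet H' := by
    rw [eH']; exact mH.inter (mb (Set.toFinite _).measurableSet)
  have hs := hasSum_condExp_indicator_inter_fiber (μ := μ) (run.G_le t) mb (mH'.inter mo)
  have hk := ae_all_iff.2 fun k => run.condExp_draw_inter_others hj t hT a k ω₁
  have h0 : ∀ k, ¬ decide (k = j) = β → H' ∩ O ∩ run.b t ⁻¹' {k} = ∅ := by
    intro k hkβ
    ext ω
    simp only [eH', Set.mem_inter_iff, Set.mem_preimage, Set.mem_ofPred_eq,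
      Set.mem_singleton_iff, Set.mem_empty_iff_false, iff_false]
    rintro ⟨⟨⟨_, h⟩, _⟩, rfl⟩
    exact hkβ h
  have h1 : ∀ k, decide (k = j) = β → H' ∩ O ∩ run.b t ⁻¹' {k} = H ∩ O ∩ run.b t ⁻¹' {k} := by
    intro k hkβ
    ext ω
    simp only [eH', Set.mem_inter_iff, Set.mem_preimage, Set.mem_ofPred_eq,
      Set.mem_singleton_iff]
    constructor
    · rintro ⟨⟨⟨h, _⟩, h'⟩, rfl⟩; exact ⟨⟨h, h'⟩, rfl⟩
    · rintro ⟨⟨h, h'⟩, rfl⟩; exact ⟨⟨⟨h, hkβ⟩, h'⟩, rfl⟩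
  filter_upwards [hs, hk] with ω hs hk hω
  rw [hs.unique (hasSum_fintype _)]
  set p := ∏ i ∈ (Finset.Ici s₀).erase j, run.drawProb s₀ t i Set.univ (run.act t ω₁ i) ω
  have hterm : ∀ k, (μ[(H' ∩ O ∩ run.b t ⁻¹' {k}).indicator (fun _ => (1 : ℝ)) | run.G t]) ω
      = p * run.drawProb s₀ t j T a ω *
        (if decide (k = j) = β then samplingProb R s₀ k else 0) := by
    intro k
    split_ifs with hkβ
    · rw [h1 k hkβ]; exact hk k hω
    · rw [h0 k hkβ, Set.indicator_empty, condExp_const (run.G_le t), mul_zero]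
  rw [Finset.sum_congr rfl fun k _ => hterm k, ← Finset.mul_sum, mul_assoc]
  congr 2
  -- The probabilities sum to one, so the event that `j` is not followed has weight `1 - ρ_j`.
  have hsum := sum_samplingProb hR s₀
  rw [← Finset.add_sum_erase _ _ (Finset.mem_univ j)] at hsum ⊢
  cases β
  · rw [Finset.sum_congr rfl (g := fun k => samplingProb R s₀ k)]
    · rw [if_neg (by simp), if_neg (by simp)]; linarith
    · intro k hk; simp [Finset.ne_of_mem_erase hk]
  · rw [Finset.sum_eq_zero]
    · simp
    · intro k hk; simp [Finset.ne_of_mem_erase hk]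

/-- Summing the joint law over the coin and over the proposals of `j` removes the factor of `j`,
whose draw probabilities sum to one. -/
theorem ArbeRun.condExp_others (run : ArbeRun B L R c δ μ) (hR : ∀ i, 0 < R i) {s₀ j : Fin M}
    (hj : s₀ ≤ j) (t : ℕ) (ω₁ : Ω) :
    ∀ᵐ ω ∂μ, run.s t ω = s₀ →
      (μ[(run.others s₀ j t ⁻¹' {run.others s₀ j t ω₁}).indicator (fun _ => (1 : ℝ)) | run.G t]) ω
        = ∏ i ∈ (Finset.Ici s₀).erase j, run.drawProb s₀ t i Set.univ (run.act t ω₁ i) ω := by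
  have mb : Measurable fun ω => decide (run.b t ω = j) :=
    (measurable_from_top (f := fun k => decide (k = j))).comp
      ((run.measurable_b t).mono (run.env.F_le _) le_rfl)
  have ma : Measurable fun ω => run.act t ω j :=
    (run.measurable_act t j).mono (run.env.F_le _) le_rfl
  have mo : MeasurableSet (run.others s₀ j t ⁻¹' {run.others s₀ j t ω₁}) :=
    run.env.F_le _ _ (run.measurable_others s₀ j t (measurableSet_singleton _))
  set O := run.others s₀ j t ⁻¹' {run.others s₀ j t ω₁} with hO
  have hs := hasSum_condExp_indicator_inter_fiber (μ := μ) (run.G_le t) ma mo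
  have hs' := ae_all_iff.2 fun a => hasSum_condExp_indicator_inter_fiber (μ := μ) (run.G_le t) mb
    (mo.inter (ma (measurableSet_singleton a)))
  have hk := ae_all_iff.2 fun a => ae_all_iff.2 fun β =>
    run.condExp_draw_inter_others_inter_decide hR hj t (MeasurableSet.univ) a β ω₁
  have e : ∀ (a : A ⊕ Linked j) (β : Bool),
      {ω' | run.choice t ω' j ∈ Set.univ ∧ run.act t ω' j = a ∧ decide (run.b t ω' = j) = β} ∩ O
      = O ∩ (fun ω => run.act t ω j) ⁻¹' {a} ∩ (fun ω => decide (run.b t ω = j)) ⁻¹' {β} := by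
    intro a β
    ext ω
    simp only [Set.mem_univ, true_and, Set.mem_inter_iff, Set.mem_ofPred_eq, Set.mem_preimage,
      Set.mem_singleton_iff]
    tauto
  simp only [← hO, e] at hk
  filter_upwards [hs, hs', hk] with ω hs hs' hk hω
  set p := ∏ i ∈ (Finset.Ici s₀).erase j, run.drawProb s₀ t i Set.univ (run.act t ω₁ i) ω
  have hterm : ∀ a, (μ[(O ∩ (fun ω => run.act t ω j) ⁻¹' {a}).indicator
      (fun _ => (1 : ℝ)) | run.G t]) ω = p * run.drawProb s₀ t j Set.univ a ω := by
    intro a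
    rw [(hs' a).unique (hasSum_fintype _), Fintype.sum_bool, hk a true hω, hk a false hω]
    simp
    ring
  simp only [hterm] at hs
  have h1 : HasSum (fun a => run.drawProb s₀ t j Set.univ a ω) 1 := (L j).hasSum_drawProb _ _ _
  rw [hs.unique (h1.mul_left p), mul_one]

/-! ### A base learner as a learner in an extended environment. -/

/-- Base learner `j`, in the epoch with smallest active index `s₀`, runs in an extension of the
environment. -/
noncomputable def ArbeRun.toStableRun (run : ArbeRun B L R c δ μ)
    (hR : ∀ i, 0 < R i) (s₀ j : Fin M) (hj : s₀ ≤ j) :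
    StableRun B (L j) (samplingProb R s₀ j) μ where
  F := run.F
  -- The other active learners' proposals count as part of the environment's move: they fix the
  -- rewards of the linked actions before `j` draws.
  G t := run.G t ⊔ MeasurableSpace.comap (run.others s₀ j t) inferInstance
  x := run.x
  r t ω := Sum.elim (run.r t ω) fun k => run.r t ω (resolve (run.act t ω) k.1)
  choice t ω := run.choice t ω j
  act t ω := run.act t ω j
  b t ω := decide (run.b t ω = j)
  -- If the index `s₀` never occurs, the infimum is empty and the start is `⊤`.
  start ω := firstTime fun l => run.s l ω = s₀
  finish ω := firstTime fun l => s₀ < run.s l ω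
  env :=
    { F_le_G := fun t => (run.env.F_le_G t).trans le_sup_left
      G_le_F_succ := fun t =>
        sup_le (run.env.G_le_F_succ t) (run.measurable_others s₀ j t).comap_le
      F_le := run.env.F_le
      measurable_context := fun t => (run.env.measurable_context t).mono le_sup_left le_rfl
      measurable_reward := fun t => (run.env.measurable_reward t).mono le_sup_left le_rfl
      reward_mem := run.env.reward_mem
      law := run.env.law }
  measurable_reward t := by
    have mr := (run.env.measurable_reward t).mono
      (le_sup_left : run.G t ≤ run.G t ⊔ MeasurableSpace.comap (run.others s₀ j t) inferInstance)
      le_rfl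
    refine @measurable_pi_lambda _ _ _
      (run.G t ⊔ MeasurableSpace.comap (run.others s₀ j t) inferInstance) _ _ fun a => ?_
    rcases a with a | k
    · exact (measurable_pi_apply a).comp mr
    · have h1 : Measurable fun p : (A → ℝ) × A => p.1 p.2 :=
        measurable_from_prod_countable_left fun a => measurable_pi_apply a
      refine h1.comp (mr.prodMk (measurable_resolve k.1 fun i hi => ?_))
      have hi' : s₀ ≤ i ∧ i ≠ j := ⟨hj.trans (k.2.le.trans hi), (k.2.trans_le hi).ne'⟩
      exact (measurable_pi_apply (⟨i, hi'⟩ : {k : Fin M // s₀ ≤ k ∧ k ≠ j})).comp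
        ((comap_measurable (run.others s₀ j t)).mono (le_sup_right : _ ≤ run.G t ⊔
          MeasurableSpace.comap (run.others s₀ j t) inferInstance) le_rfl)
  reward_mem t ω a := by
    rcases a with a | k
    · exact run.env.reward_mem t ω a
    · exact run.env.reward_mem t ω _
  measurable_choice t := run.measurable_choice t j
  measurable_act t := run.measurable_act t j
  measurable_b t := (measurable_from_top (f := fun k => decide (k = j))).comp (run.measurable_b t)
  measurable_start t := by
    have : {ω | firstTime (fun l => run.s l ω = s₀) ≤ t}
        = ⋃ l ∈ Set.Iic t, run.s l ⁻¹' {s₀} := by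
      ext ω; simp [firstTime_le_iff]
    rw [this]
    exact MeasurableSet.biUnion (Set.to_countable _) fun l hl =>
      run.monotone_F hl _ (run.measurable_s l (measurableSet_singleton s₀))
  measurable_finish t := by
    have : {ω | firstTime (fun l => s₀ < run.s l ω) ≤ t}
        = ⋃ l ∈ Set.Iic t, run.s l ⁻¹' {k | s₀ < k} := by
      ext ω; simp [firstTime_le_iff]
    rw [this]
    exact MeasurableSet.biUnion (Set.to_countable _) fun l hl =>
      run.monotone_F hl _ (run.measurable_s l (Set.toFinite _).measurableSet)
  draw t T a β hT := by
    have ma : MeasurableSet {ω' | run.choice t ω' j ∈ T ∧ run.act t ω' j = a ∧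
        decide (run.b t ω' = j) = β} := by
      have := (run.measurableSet_draw t hT a).inter
        (run.env.F_le _ _ (run.measurable_b t (Set.toFinite {k | decide (k = j) = β}).measurableSet))
      convert this using 1
      ext ω; simp [and_assoc]
    have main := condExp_sup_comap_ae_eq (μ := μ) (run.G_le t)
      ((run.measurable_others s₀ j t).mono (run.env.F_le _) le_rfl) ma
      (D := {ω | run.s t ω = s₀})
      (q := fun ω => run.drawProb s₀ t j T a ω *
        (if β then samplingProb R s₀ j else 1 - samplingProb R s₀ j))
      fun ω₁ => ⟨_, by
        filter_upwards [run.condExp_draw_inter_others_inter_decide hR hj t hT a β ω₁,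
          run.condExp_others hR hj t ω₁] with ω h1 h2 hω
        exact ⟨h1 hω, h2 hω⟩⟩
    filter_upwards [main] with ω hω t₀ hst hle hfin
    have hs : run.s t ω = s₀ := by
      have h1 : run.s t₀ ω = s₀ := (firstTime_eq_iff.1 hst).1
      refine le_antisymm ?_ (h1 ▸ run.monotone_s ω hle)
      by_contra hlt
      exact absurd ((firstTime_le_iff (p := fun l => s₀ < run.s l ω)).2 ⟨t, le_rfl, not_le.1 hlt⟩) (not_le.2 hfin)
    have e : ∀ l, Sum.elim (run.r l ω) (fun k : Linked j => run.r l ω (resolve (run.act l ω) k.1))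
        (run.act l ω j) = run.r l ω (resolve (run.act l ω) j) := fun l => by
      rw [resolve_eq_elim (run.act l ω) j]
      cases run.act l ω j <;> rfl
    rw [hω hs, ArbeRun.drawProb, (run.start_eq_iff hs t₀).1 hst]
    simp only [decide_eq_true_eq, e]

end ArbeRun

/-! ### Sampling probabilities and confidence widths -/

/-- The root of the normalizing constant of the sampling probabilities. -/
noncomputable def samplingScale {M : ℕ} (R : Fin M → ℝ) (s : Fin M) : ℝ :=
  (√(∑ j ∈ Finset.Ici s, (R j ^ 2)⁻¹))⁻¹

theorem samplingScale_pos {M : ℕ} {R : Fin M → ℝ} (hR : ∀ i, 0 < R i) (s : Fin M) :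
    0 < samplingScale R s :=
  inv_pos.2 (Real.sqrt_pos.2 (sum_inv_sq_pos hR s))

theorem samplingProb_eq {M : ℕ} {R : Fin M → ℝ} (hR : ∀ i, 0 < R i) {s i : Fin M} (h : s ≤ i) :
    samplingProb R s i = (samplingScale R s / R i) ^ 2 := by
  have h1 := sum_inv_sq_pos hR s
  have h2 := hR i
  rw [samplingProb, if_pos h, samplingScale, div_pow, inv_pow, Real.sq_sqrt h1.le]
  field_simp

theorem samplingScale_le {M : ℕ} {R : Fin M → ℝ} (hR : ∀ i, 0 < R i) {s i : Fin M} (h : s ≤ i) :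
    samplingScale R s ≤ R i := by
  have h1 := samplingProb_le_one hR s i
  have h2 := samplingScale_pos hR s
  rw [samplingProb_eq hR h, sq_le_one_iff₀ (div_nonneg h2.le (hR i).le), div_le_one (hR i)] at h1
  exact h1

theorem sqrt_div_samplingProb {M : ℕ} {R : Fin M → ℝ} (hR : ∀ i, 0 < R i) {s i : Fin M}
    (h : s ≤ i) (n z : ℝ) :
    √(n / samplingProb R s i * z) = R i / samplingScale R s * √(n * z) := by
  have h2 := samplingScale_pos hR s
  have h3 := hR i
  have e : n / samplingProb R s i * z = (R i / samplingScale R s) ^ 2 * (n * z) := by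
    rw [samplingProb_eq hR h]; field_simp
  rw [e, Real.sqrt_mul (sq_nonneg _), Real.sqrt_sq (by positivity)]

theorem confWidth_samplingProb {M : ℕ} {R : Fin M → ℝ} (hR : ∀ i, 0 < R i) {s i : Fin M}
    (h : s ≤ i) (δ : ℝ) (n : ℕ) :
    confWidth δ (samplingProb R s i) n
      = 1.44 * (R i / samplingScale R s * √(n * confLevel δ n))
        + 0.41 * (R i / samplingScale R s) ^ 2 * confLevel δ n := by
  have h2 := samplingScale_pos hR s
  have h3 := hR i
  have e : confWidth δ (samplingProb R s i) n = 1.44 * √(n / samplingProb R s i * confLevel δ n)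
    + 0.41 / samplingProb R s i * confLevel δ n := rfl
  rw [e, sqrt_div_samplingProb hR h, samplingProb_eq hR h]
  field_simp

/-- The left side is the sum of `R i ^ 2 / R j ^ 2` over active `j`: each `j ≤ i` contributes at
most `(R i / R 0) ^ 2`, each larger `j` at most 1. This bounds `1 / ρ_i` for every epoch at once. -/
theorem div_samplingScale_sq_le {M : ℕ} [NeZero M] {R : Fin M → ℝ} (hR : ∀ i, 0 < R i)
    (hmono : Monotone R) (s i : Fin M) :
    (R i / samplingScale R s) ^ 2 ≤ (R i / R 0 * √((i : ℕ) + 1 : ℝ) + M) ^ 2 := by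
  have hi := hR i
  have h0 := hR 0
  have e : (R i / samplingScale R s) ^ 2 = ∑ j ∈ Finset.Ici s, R i ^ 2 / R j ^ 2 := by
    rw [samplingScale, div_inv_eq_mul, mul_pow, Real.sq_sqrt (sum_inv_sq_pos hR s).le,
      Finset.mul_sum]
    rfl
  have h1 : ∑ j ∈ Finset.Ici s, R i ^ 2 / R j ^ 2
      ≤ ∑ j, ((if j ≤ i then (R i / R 0) ^ 2 else 0) + 1) := by
    refine (Finset.sum_le_sum_of_subset_of_nonneg (Finset.subset_univ _) fun j _ _ => by
      positivity).trans (Finset.sum_le_sum fun j _ => ?_)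
    have hj := hR j
    have hj0 : R 0 ≤ R j := hmono (Fin.zero_le j)
    split_ifs with hji
    · rw [div_pow]
      have : R i ^ 2 / R j ^ 2 ≤ R i ^ 2 / R 0 ^ 2 := by gcongr
      linarith
    · rw [zero_add, ← div_pow]
      exact pow_le_one₀ (by positivity) ((div_le_one hj).2 (hmono (not_le.1 hji).le))
  have h2 : ∑ j, ((if j ≤ i then (R i / R 0) ^ 2 else 0) + 1)
      = ((i : ℕ) + 1 : ℝ) * (R i / R 0) ^ 2 + M := by
    rw [Finset.sum_add_distrib, ← Finset.sum_filter, Finset.sum_const, Finset.sum_const]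
    have : Finset.univ.filter (fun j => j ≤ i) = Finset.Iic i := by ext; simp
    rw [this, Fin.card_Iic]
    simp
  have hM : (1 : ℝ) ≤ M := by exact_mod_cast NeZero.one_le
  have hsq : (√((i : ℕ) + 1 : ℝ)) ^ 2 = (i : ℕ) + 1 := Real.sq_sqrt (by positivity)
  rw [e]
  refine h1.trans ?_
  rw [h2]
  have hpos : 0 ≤ R i / R 0 * √((i : ℕ) + 1 : ℝ) * M := by positivity
  nlinarith

/-- If every active base learner does almost as well as a benchmark `V`, then so does their
mixture with respect to the sampling probabilities. -/
theorem sub_sum_samplingProb_mul_le {M : ℕ} [NeZero M] {R : Fin M → ℝ} (hR : ∀ i, 1 ≤ R i)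
    (hmono : Monotone R) {s k : Fin M} (hs : s ≤ k) {c δ l V : ℝ} {n : ℕ} (hc : 0 ≤ c)
    (hl : 0 ≤ l) (hlev : 0 ≤ confLevel δ n) (hlev' : confLevel δ n ≤ 10 * l) {E : Fin M → ℝ}
    (h : ∀ i, s ≤ i → V - E i ≤ c * (R i * √(n / samplingProb R s i * l))
      + confWidth δ (samplingProb R s i) n + (2 * confWidth δ (samplingProb R s k) n
        + c * (R k * √(n / samplingProb R s k * l)))) :
    V - ∑ i ∈ Finset.Ici s, samplingProb R s i * E i
      ≤ (2 * c + 15) * ((R k / R 0 * √((k : ℕ) + 1 : ℝ) + M) * R k * √(n * l))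
        + 13 * ((R k / R 0 * √((k : ℕ) + 1 : ℝ) + M) ^ 2 * l) := by
  have hR0 : ∀ i, 0 < R i := fun i => zero_lt_one.trans_le (hR i)
  set W := samplingScale R s with hW
  have hW0 : 0 < W := samplingScale_pos hR0 s
  set Γ := R k / R 0 * √((k : ℕ) + 1 : ℝ) + M with hΓ
  have hM : (1 : ℝ) ≤ M := by exact_mod_cast NeZero.one_le
  have hΓM : (M : ℝ) ≤ Γ := by
    have := hR0 k; have := hR0 0
    have : 0 ≤ R k / R 0 * √((k : ℕ) + 1 : ℝ) := by positivity
    linarith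
  have hΓ1 : 1 ≤ Γ := hM.trans hΓM
  set Q := R k / W with hQ
  have hQ0 : 0 ≤ Q := (div_pos (hR0 k) hW0).le
  have hQΓ : Q ≤ Γ := by
    have := div_samplingScale_sq_le hR0 hmono s k
    exact (pow_le_pow_iff_left₀ hQ0 (by linarith) two_ne_zero).1 this
  set v := confLevel δ n with hv
  set Sl := √(n * l) with hSl
  set Sv := √(n * v) with hSv
  have hSl0 : 0 ≤ Sl := Real.sqrt_nonneg _
  have hSv0 : 0 ≤ Sv := Real.sqrt_nonneg _
  -- Here `3.2 ^ 2 > 10`, the factor between the two logarithmic levels.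
  have hSvl : Sv ≤ 3.2 * Sl := by
    rw [hSv, hSl]
    apply Real.sqrt_le_iff.2 ⟨by positivity, ?_⟩
    rw [mul_pow, Real.sq_sqrt (by positivity)]
    have : (n : ℝ) * v ≤ n * (10 * l) := by gcongr
    have : 0 ≤ (n : ℝ) * l := by positivity
    nlinarith
  set E₀ := 2 * (1.44 * (Q * Sv) + 0.41 * Q ^ 2 * v) + c * (R k * (Q * Sl)) with hE₀
  have hE₀0 : 0 ≤ E₀ := by have := hR0 k; positivity
  -- Balancing: with `ρ_i = (W / R i) ^ 2`, the stability term becomes `c * W * Sl`, free of `i`.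
  -- The part `E₀` belongs to `k` and keeps total weight one in the sum.
  have hterm : ∀ i ∈ Finset.Ici s, samplingProb R s i * (V - E i)
      ≤ (c * R k * Sl + 1.44 * Sv + 0.41 * v) + samplingProb R s i * E₀ := by
    intro i hi
    have hsi := Finset.mem_Ici.1 hi
    have hi0 := hR0 i
    have h1 := h i hsi
    rw [sqrt_div_samplingProb hR0 hsi, sqrt_div_samplingProb hR0 hs,
      confWidth_samplingProb hR0 hsi, confWidth_samplingProb hR0 hs] at h1
    have h2 := mul_le_mul_of_nonneg_left h1 (samplingProb_nonneg R s i)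
    refine h2.trans ?_
    rw [mul_add]
    refine add_le_add ?_ le_rfl
    rw [samplingProb_eq hR0 hsi, ← hW]
    have e : (W / R i) ^ 2 * (c * (R i * (R i / W * Sl))
        + (1.44 * (R i / W * Sv) + 0.41 * (R i / W) ^ 2 * v))
        = c * W * Sl + 1.44 * (W / R i) * Sv + 0.41 * v := by
      field_simp
      ring
    have h3 : W / R i ≤ 1 := (div_le_one hi0).2 (samplingScale_le hR0 hsi)
    have h4 : W ≤ R k := samplingScale_le hR0 hs
    calc _ = c * W * Sl + 1.44 * (W / R i) * Sv + 0.41 * v := e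
      _ ≤ c * R k * Sl + 1.44 * 1 * Sv + 0.41 * v := by gcongr
      _ = _ := by ring
  have hsum := Finset.sum_le_sum hterm
  have h1 := sum_Ici_samplingProb hR0 s
  rw [Finset.sum_add_distrib, ← Finset.sum_mul, h1, one_mul, Finset.sum_const, nsmul_eq_mul] at hsum
  simp only [mul_sub] at hsum
  rw [Finset.sum_sub_distrib, ← Finset.sum_mul, h1, one_mul] at hsum
  have hcard : ((Finset.Ici s).card : ℝ) ≤ M := by
    have := Finset.card_le_univ (Finset.Ici s)
    rw [Fintype.card_fin] at this
    exact_mod_cast this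
  have hk := hR k
  have hk0 := hR0 k
  have b0 : 0 ≤ c * R k * Sl + 1.44 * Sv + 0.41 * v := by positivity
  have b1 : ((Finset.Ici s).card : ℝ) * (c * R k * Sl + 1.44 * Sv + 0.41 * v)
      ≤ Γ * (c * R k * Sl + 1.44 * (3.2 * Sl) + 0.41 * (10 * l)) := by
    have := hcard.trans hΓM
    gcongr
  have b2 : E₀ ≤ 2 * (1.44 * (Γ * (3.2 * Sl)) + 0.41 * Γ ^ 2 * (10 * l)) + c * (R k * (Γ * Sl)) := by
    rw [hE₀]; gcongr
  have b3 : Γ * Sl ≤ Γ * R k * Sl := by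
    have : 0 ≤ Γ * Sl := by positivity
    nlinarith
  have b4 : Γ * l ≤ Γ ^ 2 * l := by
    have : 0 ≤ Γ * l := by positivity
    nlinarith
  have b5 : 0 ≤ Γ * R k * Sl := by positivity
  have b6 : 0 ≤ Γ ^ 2 * l := by positivity
  have f1 : Γ * (c * R k * Sl + 1.44 * (3.2 * Sl) + 0.41 * (10 * l))
      = c * (Γ * R k * Sl) + 1.44 * 3.2 * (Γ * Sl) + 4.1 * (Γ * l) := by ring
  have f2 : 2 * (1.44 * (Γ * (3.2 * Sl)) + 0.41 * Γ ^ 2 * (10 * l)) + c * (R k * (Γ * Sl))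
      = 2 * 1.44 * 3.2 * (Γ * Sl) + 8.2 * (Γ ^ 2 * l) + c * (Γ * R k * Sl) := by ring
  rw [f1] at b1
  rw [f2] at b2
  -- The constants are `3 * 1.44 * 3.2 < 15` and `4.1 + 8.2 < 13`.
  have f3 : (2 * c + 15) * (Γ * R k * Sl) = 2 * (c * (Γ * R k * Sl)) + 15 * (Γ * R k * Sl) := by ring
  rw [f3]
  linarith

/-- A lower-order term can be absorbed, because the regret is at most `n`. -/
theorem le_add_mul_sqrt_of_le_add {V a g l : ℝ} {n : ℝ} (hn : 0 ≤ n) (hl : 0 ≤ l) (ha : 0 ≤ a)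
    (hg : 0 ≤ g) (h1 : V ≤ n) (h2 : V ≤ a + 13 * (g ^ 2 * l)) : V ≤ a + 4 * (g * √(n * l)) := by
  set S := √(n * l) with hS
  have hS0 : 0 ≤ S := Real.sqrt_nonneg _
  have hS2 : S ^ 2 = n * l := Real.sq_sqrt (by positivity)
  by_contra! h
  have h3 : 4 * (g * S) < 13 * (g ^ 2 * l) := by linarith
  have h4 : 4 * (g * S) < n := by linarith
  have hgS : 0 ≤ g * S := by positivity
  -- Otherwise `4 g S` is below both `n` and `13 g² l`; the product of the two contradicts `16 >
  -- 13`.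
  have h5 : (4 * (g * S)) * (4 * (g * S)) ≤ n * (13 * (g ^ 2 * l)) := by gcongr
  have h6 : (g * S) ^ 2 = n * (g ^ 2 * l) := by rw [mul_pow, hS2]; ring
  have h7 : 0 < g ^ 2 * l := by nlinarith
  have h8 : 0 < n := by linarith
  nlinarith [mul_pos h8 h7]

/-- Since `log (1 / δ) ≥ log 3`, the constants in the level are absorbed; for `δ` near 1 and `t = 1`
the right side would tend to zero. -/
theorem confLevel_le {δ : ℝ} (h0 : 0 < δ) (h1 : δ ≤ 1 / 3) {n t : ℝ} (hn : 1 ≤ n) (hnt : n ≤ t) :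
    confLevel δ n ≤ 10 * Real.log (t / δ) := by
  have ht : 1 ≤ t := hn.trans hnt
  have h2 := log_four_mul_ge hn
  have h3 : Real.log (Real.log (4 * n)) ≤ Real.log (4 * n) - 1 :=
    Real.log_le_sub_one_of_pos (by linarith)
  have h4 : Real.log (4 * n) ≤ Real.log (4 * t) := Real.log_le_log (by linarith) (by linarith)
  have h5 : Real.log (4 * t) = Real.log 4 + Real.log t := Real.log_mul (by norm_num) (by linarith)
  have h6 : Real.log (t / δ) = Real.log t + Real.log (1 / δ) := by
    rw [← Real.log_mul (by linarith) (by positivity)]; congr 1; ring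
  have h7 : Real.log (5.2 / δ) = Real.log 5.2 + Real.log (1 / δ) := by
    rw [← Real.log_mul (by norm_num) (by positivity)]; congr 1; ring
  have h8 : Real.log 3 ≤ Real.log (1 / δ) := Real.log_le_log (by norm_num) (by
    rw [le_div_iff₀ h0]; linarith)
  have h9 : Real.log 4 ≤ 2 * Real.log 3 := by
    rw [← Real.log_rpow (by norm_num)]
    exact Real.log_le_log (by norm_num) (by norm_num)
  have h10 : Real.log 5.2 ≤ 2 * Real.log 3 := by
    rw [← Real.log_rpow (by norm_num)]
    exact Real.log_le_log (by norm_num) (by norm_num)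
  have h11 : 0 ≤ Real.log t := Real.log_nonneg ht
  have h12 : 0 ≤ Real.log 3 := Real.log_nonneg (by norm_num)
  unfold confLevel
  linarith

/-! ### Values of policies -/

theorem PMF.hasSum_toReal {A : Type} (p : PMF A) : HasSum (fun a => (p a).toReal) 1 := by
  have h := ENNReal.hasSum_toReal p.tsum_coe_ne_top
  have h2 := ENNReal.tsum_toReal_eq p.apply_ne_top
  rw [p.tsum_coe, ENNReal.toReal_one] at h2
  rwa [← h2] at h

theorem Policy.value_le_one {X A : Type} (π : Policy X A) (x : X) {r : A → ℝ}
    (hr : ∀ a, r a ∈ Set.Icc (0 : ℝ) 1) : π.value x r ≤ 1 := by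
  have h := (π x).hasSum_toReal
  have hle : ∀ a, (π x a).toReal * r a ≤ (π x a).toReal := fun a =>
    mul_le_of_le_one_right ENNReal.toReal_nonneg (hr a).2
  rw [← h.tsum_eq]
  exact (h.summable.of_nonneg_of_le (fun a => mul_nonneg ENNReal.toReal_nonneg (hr a).1)
    hle).tsum_le_tsum hle h.summable

theorem Policy.value_extend {X A K : Type} (π : Policy X A) (x : X) (r : A ⊕ K → ℝ) :
    Policy.value (Policy.extend K π) x r = π.value x fun a => r (Sum.inl a) := by
  unfold Policy.value Policy.extend
  have h1 : ∀ a : A, (PMF.map Sum.inl (π x) : PMF (A ⊕ K)) (Sum.inl a) = π x a := fun a => by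
    classical
    simp [PMF.map_apply]
  rw [← Sum.inl_injective.tsum_eq]
  · simp only [h1]
  · rintro (a | k) h
    · exact ⟨a, rfl⟩
    · simp at h

theorem Policy.value_special {X A K : Type} (k : K) (x : X) (r : A ⊕ K → ℝ) :
    Policy.value (Policy.special X A k) x r = r (Sum.inr k) := by
  unfold Policy.value Policy.special
  rw [tsum_eq_single (Sum.inr k)]
  · simp
  · intro a ha; simp [ha]

theorem sum_le_of_regret_le {X A : Type} {P : Set (Policy X A)} {x : ℕ → X} {r : ℕ → A → ℝ}
    {a : ℕ → A} {t₀ t : ℕ} {b : ℝ} (h : regret P x r a t₀ t ≤ (b : EReal)) {π : Policy X A}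
    (hπ : π ∈ P) : ∑ l ∈ Finset.Ico t₀ t, (π.value (x l) (r l) - r l (a l)) ≤ b :=
  EReal.coe_le_coe_iff.1 ((le_iSup₂ (f := fun (π : Policy X A) (_ : π ∈ P) =>
    ((∑ l ∈ Finset.Ico t₀ t, (π.value (x l) (r l) - r l (a l)) : ℝ) : EReal)) π hπ).trans h)

/-! ### Regret on the good event. -/

section ArbeRun

variable {X A Ω : Type} {M : ℕ} [MeasurableSpace X] [MeasurableSpace A] [mΩ : MeasurableSpace Ω]
  {B : Environment X A} {L : (i : Fin M) → Learner X (A ⊕ Linked i)} {R : Fin M → ℝ} {c δ : ℝ}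
  {μ : Measure Ω}

/-- The reward that base learner `j` would have received, had it always been followed. -/
def ArbeRun.reward (run : ArbeRun B L R c δ μ) (ω : Ω) (j : Fin M) (t₀ t : ℕ) : ℝ :=
  ∑ l ∈ Finset.Ico t₀ t, run.r l ω (resolve (run.act l ω) j)

/-- The estimate of `ArbeRun.reward` in an epoch with smallest active index `s`. -/
noncomputable def ArbeRun.estimate (run : ArbeRun B L R c δ μ) (ω : Ω) (s j : Fin M) (t₀ t : ℕ) :
    ℝ :=
  rewardEstimate (samplingProb R s j) j (fun l => run.b l ω)
    (fun l => run.r l ω (resolve (run.act l ω) (run.b l ω))) t₀ t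

/-- The estimates and the stability bounds of all base learners from `k` on are correct, in all
epochs in which they are active. -/
structure ArbeRun.Good (run : ArbeRun B L R c δ μ) (k : Fin M) (P : Set (Policy X A)) (ω : Ω) :
    Prop where
  -- An epoch is named by one of its rounds `T`; `t = T + 1` is allowed because the test is
  -- evaluated after round `T`.
  conf : ∀ (T t : ℕ) (j : Fin M), k ≤ j → run.s T ω ≤ j → run.start T ω < t → t ≤ T + 1 →
    |run.estimate ω (run.s T ω) j (run.start T ω) t - run.reward ω j (run.start T ω) t|
      ≤ confWidth δ (samplingProb R (run.s T ω) j) (t - run.start T ω)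
  stable : ∀ (T t : ℕ) (j : Fin M), k ≤ j → run.s T ω ≤ j → run.start T ω < t → t ≤ T + 1 →
    ∀ π ∈ P, ∑ l ∈ Finset.Ico (run.start T ω) t, π.value (run.x l ω) (run.r l ω)
      - run.reward ω j (run.start T ω) t
      ≤ c * (R j * √((t - run.start T ω : ℝ) / samplingProb R (run.s T ω) j
        * Real.log ((t - run.start T ω : ℝ) / δ)))
  stable_linked : ∀ (T t : ℕ) (j : Fin M), k ≤ j → run.s T ω ≤ j → run.start T ω < t → t ≤ T + 1 →
    ∀ i, j < i → run.reward ω i (run.start T ω) t - run.reward ω j (run.start T ω) t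
      ≤ c * (R j * √((t - run.start T ω : ℝ) / samplingProb R (run.s T ω) j
        * Real.log ((t - run.start T ω : ℝ) / δ)))

/-- Reconciles three logarithms: epoch length in the stability bound, current time in the test,
final time in the regret bound. -/
theorem ArbeRun.stability_bound_mono (hc : 0 ≤ c) (hR : ∀ i, 0 ≤ R i) (h0 : 0 < δ) (s j : Fin M)
    {n : ℝ} (hn : 0 ≤ n) {y z : ℝ} (hy : 0 < y) (hyz : y ≤ z) :
    c * (R j * √(n / samplingProb R s j * Real.log (y / δ)))
      ≤ c * (R j * √(n / samplingProb R s j * Real.log (z / δ))) := by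
  have := samplingProb_nonneg R s j
  have := hR j
  have h1 : Real.log (y / δ) ≤ Real.log (z / δ) := Real.log_le_log (by positivity) (by gcongr)
  gcongr

/-- On the good event, no base learner from `k` on is discarded. -/
theorem ArbeRun.Good.s_le {run : ArbeRun B L R c δ μ} {k : Fin M} {P : Set (Policy X A)} {ω : Ω}
    (h : run.Good k P ω) (hc : 0 ≤ c) (hR : ∀ i, 0 ≤ R i) (h0 : 0 < δ) (T : ℕ) :
    run.s T ω ≤ k := by
  induction T with
  | zero => rw [Fin.le_def, run.s_zero]; exact Nat.zero_le _
  | succ T ih =>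
    by_cases hT : ∃ i j, TestTriggers R c δ (fun l => run.b l ω)
        (fun l => run.r l ω (resolve (run.act l ω) (run.b l ω))) (run.s T ω) (run.start T ω)
        (T + 1) i j
    · obtain ⟨i, j, ⟨hsi, hij, htest⟩, hs, -⟩ := run.step_restart T ω hT
      rw [Fin.le_def, hs]
      by_contra hlt
      -- A test that discards `i ≥ k` is refuted by the two confidence bounds and the stability of
      -- `i` against the linked action of `j`.
      have hki : k ≤ i := Fin.le_def.2 (by omega)
      have hst : run.start T ω < T + 1 := Nat.lt_succ_of_le (run.epoch T ω).1
      have c1 := abs_le.1 (h.conf T (T + 1) i hki hsi hst le_rfl)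
      have c2 := abs_le.1 (h.conf T (T + 1) j (hki.trans hij.le) (hsi.trans hij.le) hst le_rfl)
      have c3 := h.stable_linked T (T + 1) i hki hsi hst le_rfl j hij
      have hst' : (run.start T ω : ℝ) < ((T + 1 : ℕ) : ℝ) := by exact_mod_cast hst
      have c4 := ArbeRun.stability_bound_mono (R := R) hc hR h0 (run.s T ω) i
        (sub_nonneg.2 hst'.le) (sub_pos.2 hst') (sub_le_self ((T + 1 : ℕ) : ℝ)
        (Nat.cast_nonneg (run.start T ω)))
      simp only [ArbeRun.estimate] at c1 c2
      linarith [c1.1, c2.2]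
    · rw [(run.step_continue T ω (by simpa using hT)).1]; exact ih

/-- Within an epoch no test has triggered. -/
theorem ArbeRun.not_testTriggers (run : ArbeRun B L R c δ μ) {T : ℕ} {ω : Ω}
    (hT : run.start T ω < T) (i j : Fin M) :
    ¬ TestTriggers R c δ (fun l => run.b l ω)
        (fun l => run.r l ω (resolve (run.act l ω) (run.b l ω))) (run.s T ω) (run.start T ω)
        T i j := by
  obtain ⟨T, rfl⟩ : ∃ T', T = T' + 1 := ⟨T - 1, by omega⟩
  obtain ⟨hs, hst⟩ := (run.epoch (T + 1) ω).2.1 T (by omega) (by omega)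
  intro h
  rw [← hs, ← hst] at h
  obtain ⟨-, -, -, -, h1⟩ := run.step_restart T ω ⟨i, j, h⟩
  omega

/-- The received reward, in terms of the importance-weighted estimates. -/
theorem ArbeRun.sum_samplingProb_mul_estimate_le (run : ArbeRun B L R c δ μ) (hR : ∀ i, 0 < R i)
    (ω : Ω) (s : Fin M) (t₀ t : ℕ) :
    ∑ i ∈ Finset.Ici s, samplingProb R s i * run.estimate ω s i t₀ t
      ≤ ∑ l ∈ Finset.Ico t₀ t, run.r l ω (run.played l ω) := by
  simp only [ArbeRun.estimate, rewardEstimate, Finset.mul_sum]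
  rw [Finset.sum_comm]
  refine Finset.sum_le_sum fun l _ => ?_
  have hy := (run.env.reward_mem l ω (run.played l ω)).1
  have e : ∀ i ∈ Finset.Ici s, samplingProb R s i * (if run.b l ω = i then
      run.r l ω (resolve (run.act l ω) (run.b l ω)) / samplingProb R s i else 0)
      = if run.b l ω = i then run.r l ω (run.played l ω) else 0 := by
    intro i hi
    have := samplingProb_pos hR (Finset.mem_Ici.1 hi)
    split_ifs
    · rw [mul_div_cancel₀ _ this.ne']; rfl
    · rw [mul_zero]
  -- An inactive index is drawn with probability zero only, so pointwise it costs an inequality, by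
  -- nonnegativity of rewards.
  rw [Finset.sum_congr rfl e, Finset.sum_ite_eq]
  split_ifs
  · exact le_rfl
  · exact hy

variable [NeZero M]

/-- The regret in an epoch, on the good event. -/
theorem ArbeRun.Good.epoch_le {run : ArbeRun B L R c δ μ} {k : Fin M} {P : Set (Policy X A)}
    {ω : Ω} (h : run.Good k P ω) (hc : 0 ≤ c) (hR : ∀ i, 1 ≤ R i) (hmono : Monotone R)
    (h0 : 0 < δ) (h1 : δ ≤ 1 / 3) {T t : ℕ} (hTt : T ≤ t) (hT : run.start T ω < T)
    {π : Policy X A} (hπ : π ∈ P) :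
    ∑ l ∈ Finset.Ico (run.start T ω) T,
        (π.value (run.x l ω) (run.r l ω) - run.r l ω (run.played l ω))
      ≤ (2 * c + 19) * ((R k / R 0 * √((k : ℕ) + 1 : ℝ) + M) * R k
        * √((T - run.start T ω : ℕ) * Real.log (t / δ))) := by
  have hR0 : ∀ i, 0 < R i := fun i => zero_lt_one.trans_le (hR i)
  have hR0' : ∀ i, 0 ≤ R i := fun i => (hR0 i).le
  set t₀ := run.start T ω with ht₀
  set s := run.s T ω with hs
  set n := T - t₀ with hn
  set l := Real.log (t / δ) with hl
  have hsk : s ≤ k := h.s_le hc hR0' h0 T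
  have hnT : ((n : ℕ) : ℝ) = (T : ℝ) - t₀ := by rw [hn, Nat.cast_sub hT.le]
  have hn1 : (1 : ℝ) ≤ n := by
    have : 1 ≤ n := by omega
    exact_mod_cast this
  have hTt' : (T : ℝ) ≤ t := by exact_mod_cast hTt
  have hnt : (n : ℝ) ≤ T := by rw [hnT]; linarith [(Nat.cast_nonneg t₀ : (0 : ℝ) ≤ t₀)]
  have hl0 : 0 ≤ l := Real.log_nonneg (by rw [le_div_iff₀ h0]; linarith)
  have hlev := (confLevel_pos h0 (by linarith) hn1).le
  have hlev' := confLevel_le h0 h1 hn1 (hnt.trans hTt')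
  set V := ∑ l ∈ Finset.Ico t₀ T, π.value (run.x l ω) (run.r l ω) with hV
  set Γ := R k / R 0 * √((k : ℕ) + 1 : ℝ) + M with hΓ
  have hΓ0 : 0 ≤ Γ := by have := hR0 k; have := hR0 0; positivity
  have hk0 := hR0 k
  have hwidth : ∀ i, 0 ≤ confWidth δ (samplingProb R s i) n := fun i => by
    have e : confWidth δ (samplingProb R s i) n = 1.44 * √(n / samplingProb R s i * confLevel δ n)
      + 0.41 / samplingProb R s i * confLevel δ n := rfl
    have := samplingProb_nonneg R s i
    rw [e]; positivity
  have hstab : ∀ i, k ≤ i → V - run.estimate ω s i t₀ T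
      ≤ c * (R i * √(n / samplingProb R s i * l)) + confWidth δ (samplingProb R s i) n := by
    intro i hi
    have a1 := (abs_le.1 (h.conf T T i hi (hsk.trans hi) hT T.le_succ)).1
    have a2 := h.stable T T i hi (hsk.trans hi) hT T.le_succ π hπ
    have a3 := ArbeRun.stability_bound_mono (R := R) hc hR0' h0 s i (n := n) (by linarith)
      (by linarith : (0 : ℝ) < n) (hnt.trans hTt')
    rw [← hnT] at a2
    linarith
  -- For `i ≥ k` the learner's own stability suffices. For `i < k` the benchmark is compared with
  -- `k`, and `k` with `i` through the test that has not triggered.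
  have key := sub_sum_samplingProb_mul_le hR hmono hsk hc hl0 hlev hlev'
    (V := V) (E := fun i => run.estimate ω s i t₀ T) (fun i hsi => by
      have b1 : 0 ≤ c * (R k * √(n / samplingProb R s k * l)) := by positivity
      have b2 := hwidth k
      rcases le_or_gt k i with hki | hik
      · have := hstab i hki
        linarith
      · have a1 := hstab k le_rfl
        have a2 := run.not_testTriggers hT i k
        rw [TestTriggers, not_and, not_and, not_lt] at a2
        have a3 := a2 hsi hik
        rw [← ht₀, ← hs, ← hnT] at a3
        have a4 := ArbeRun.stability_bound_mono (R := R) hc hR0' h0 s i (n := n) (by linarith)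
          (by linarith : (0 : ℝ) < T) hTt'
        simp only [ArbeRun.estimate] at a1 ⊢
        linarith)
  have hplay := run.sum_samplingProb_mul_estimate_le hR0 ω s t₀ T
  rw [Finset.sum_sub_distrib, ← hV]
  have htriv : V - ∑ l ∈ Finset.Ico t₀ T, run.r l ω (run.played l ω) ≤ n := by
    rw [hV, ← Finset.sum_sub_distrib]
    refine (Finset.sum_le_sum (g := fun _ => (1 : ℝ)) fun l _ => ?_).trans (by simp [hn])
    have := π.value_le_one (run.x l ω) (run.env.reward_mem l ω)
    have := (run.env.reward_mem l ω (run.played l ω)).1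
    linarith
  -- The trivial bound `n` absorbs the term `Γ² l`, raising 15 to 19.
  have fin := le_add_mul_sqrt_of_le_add (n := n) (by linarith) hl0 (by positivity) hΓ0 htriv
    ((sub_le_sub_left hplay V).trans key)
  refine fin.trans ?_
  have : Γ * √(n * l) * 1 ≤ Γ * √(n * l) * R k := by
    have := hR k
    gcongr
  linarith

/-- The regret in an epoch, up to and including its last round. -/
theorem ArbeRun.Good.epoch_succ_le {run : ArbeRun B L R c δ μ} {k : Fin M} {P : Set (Policy X A)}
    {ω : Ω} (h : run.Good k P ω) (hc : 0 ≤ c) (hR : ∀ i, 1 ≤ R i) (hmono : Monotone R)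
    (h0 : 0 < δ) (h1 : δ ≤ 1 / 3) {T t : ℕ} (hTt : T < t) {π : Policy X A} (hπ : π ∈ P) :
    ∑ l ∈ Finset.Ico (run.start T ω) (T + 1),
        (π.value (run.x l ω) (run.r l ω) - run.r l ω (run.played l ω))
      ≤ (2 * c + 20) * ((R k / R 0 * √((k : ℕ) + 1 : ℝ) + M) * R k
        * √((T + 1 - run.start T ω : ℕ) * Real.log (t / δ))) := by
  have hR0 : ∀ i, 0 < R i := fun i => zero_lt_one.trans_le (hR i)
  have hst := (run.epoch T ω).1
  set t₀ := run.start T ω with ht₀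
  set l := Real.log (t / δ) with hl
  have hl1 : 1 ≤ l := by
    have ht : (1 : ℝ) ≤ t := by exact_mod_cast (by omega : 1 ≤ t)
    rw [hl, Real.le_log_iff_exp_le (by positivity), le_div_iff₀ h0]
    have := Real.exp_one_lt_d9
    nlinarith
  set Γ := R k / R 0 * √((k : ℕ) + 1 : ℝ) + M with hΓ
  have hΓ1 : 1 ≤ Γ := by
    have := hR0 k; have := hR0 0
    have : 0 ≤ R k / R 0 * √((k : ℕ) + 1 : ℝ) := by positivity
    have hM : (1 : ℝ) ≤ M := by exact_mod_cast NeZero.one_le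
    linarith
  have hk := hR k
  -- The test after the last round may trigger, so that round is charged its trivial cost 1. This
  -- fits into the bound since `log (t / δ) ≥ 1`, as `1 / δ ≥ 3 > e`.
  have hlast : π.value (run.x T ω) (run.r T ω) - run.r T ω (run.played T ω) ≤ 1 := by
    have := π.value_le_one (run.x T ω) (run.env.reward_mem T ω)
    have := (run.env.reward_mem T ω (run.played T ω)).1
    linarith
  have hN : (1 : ℝ) ≤ (T + 1 - t₀ : ℕ) := by exact_mod_cast (by omega : 1 ≤ T + 1 - t₀)
  have hone : 1 ≤ Γ * R k * √((T + 1 - t₀ : ℕ) * l) := by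
    have : 1 ≤ √((T + 1 - t₀ : ℕ) * l) := Real.one_le_sqrt.2 (by nlinarith)
    exact one_le_mul_of_one_le_of_one_le (one_le_mul_of_one_le_of_one_le hΓ1 hk) this
  rw [Finset.sum_Ico_succ_top hst]
  rcases hst.lt_or_eq with hlt | heq
  · have h2 := h.epoch_le hc hR hmono h0 h1 hTt.le hlt hπ
    have h3 : √((T - t₀ : ℕ) * l) ≤ √((T + 1 - t₀ : ℕ) * l) := by
      have : ((T - t₀ : ℕ) : ℝ) ≤ (T + 1 - t₀ : ℕ) := by exact_mod_cast (by omega)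
      gcongr
    have h4 : (2 * c + 19) * (Γ * R k * √((T - t₀ : ℕ) * l))
        ≤ (2 * c + 19) * (Γ * R k * √((T + 1 - t₀ : ℕ) * l)) := by gcongr
    linarith
  · rw [heq, Finset.Ico_self, Finset.sum_empty, zero_add]
    rw [heq] at hone
    nlinarith

/-- The regret bound holds on the good event. -/
theorem ArbeRun.Good.regret_le {run : ArbeRun B L R c δ μ} {k : Fin M} {P : Set (Policy X A)}
    {ω : Ω} (h : run.Good k P ω) (hc : 0 ≤ c) (hR : ∀ i, 1 ≤ R i) (hmono : Monotone R)
    (h0 : 0 < δ) (h1 : δ ≤ 1 / 3) (t : ℕ) :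
    regret P (fun l => run.x l ω) (fun l => run.r l ω) (fun l => run.played l ω) 0 t
      ≤ (((2 * c + 20) * ((R k / R 0 * √((k : ℕ) + 1 : ℝ) + M) * R k
        * √(((k : ℕ) + 1 : ℝ) * t * Real.log (t / δ))) : ℝ) : EReal) := by
  classical
  have hR0 : ∀ i, 0 < R i := fun i => zero_lt_one.trans_le (hR i)
  refine iSup₂_le fun π hπ => EReal.coe_le_coe_iff.2 ?_
  set d : ℕ → ℝ := fun l => π.value (run.x l ω) (run.r l ω) - run.r l ω (run.played l ω) with hd
  set Γ := R k / R 0 * √((k : ℕ) + 1 : ℝ) + M with hΓ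
  have hΓ0 : 0 ≤ Γ := by have := hR0 k; have := hR0 0; positivity
  have hk0 := hR0 k
  set N : Fin M → Finset ℕ := fun s => (Finset.range t).filter fun l => run.s l ω = s with hN
  have hmaps : ∀ l ∈ Finset.range t, run.s l ω ∈ Finset.Iic k := fun l _ =>
    Finset.mem_Iic.2 (h.s_le hc (fun i => (hR0 i).le) h0 l)
  -- The rounds before `t` with index `s` form one epoch, cut off at `t`; `T` is its last round.
  have hfib : ∀ s, ∑ l ∈ N s, d l
      ≤ (2 * c + 20) * (Γ * R k * √((N s).card * Real.log (t / δ))) := by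
    intro s
    rcases (N s).eq_empty_or_nonempty with he | hne
    · simp [he]
    · set T := (N s).max' hne with hT
      have hTmem := (N s).max'_mem hne
      rw [← hT, hN, Finset.mem_filter, Finset.mem_range] at hTmem
      obtain ⟨e1, e2, e3⟩ := run.epoch T ω
      have hIco : N s = Finset.Ico (run.start T ω) (T + 1) := by
        ext l
        rw [Finset.mem_Ico]
        constructor
        · intro hl
          have hle : l ≤ T := (N s).le_max' l hl
          rw [hN, Finset.mem_filter] at hl
          refine ⟨?_, by omega⟩
          by_contra hlt
          have := e3 l (not_le.1 hlt)
          rw [hl.2, hTmem.2] at this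
          exact lt_irrefl _ this
        · rintro ⟨hl1, hl2⟩
          rw [hN, Finset.mem_filter, Finset.mem_range]
          exact ⟨by omega, by rw [(e2 l hl1 (by omega)).1, hTmem.2]⟩
      rw [hIco, Nat.card_Ico]
      exact h.epoch_succ_le hc hR hmono h0 h1 hTmem.1 hπ
  rw [← Finset.range_eq_Ico, ← Finset.sum_fiberwise_of_maps_to hmaps]
  refine (Finset.sum_le_sum fun s _ => hfib s).trans ?_
  rw [← Finset.mul_sum, ← Finset.mul_sum]
  have hcard : ∑ s ∈ Finset.Iic k, ((N s).card : ℝ) = t := by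
    have := Finset.card_eq_sum_card_fiberwise hmaps
    rw [Finset.card_range] at this
    exact_mod_cast this.symm
  -- Cauchy–Schwarz over at most `k + 1` epochs whose lengths add up to `t`.
  have hsqrt : ∑ s ∈ Finset.Iic k, √((N s).card * Real.log (t / δ))
      ≤ √(((k : ℕ) + 1 : ℝ) * t * Real.log (t / δ)) := by
    apply Real.le_sqrt_of_sq_le
    refine sq_sum_le_card_mul_sum_sq.trans ?_
    rcases Nat.eq_zero_or_pos t with rfl | htpos
    · simp [hN]
    have hl0 : 0 ≤ Real.log (t / δ) := Real.log_nonneg (by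
      have : (1 : ℝ) ≤ t := by exact_mod_cast htpos
      rw [le_div_iff₀ h0]; linarith)
    rw [Finset.sum_congr rfl fun s _ => Real.sq_sqrt (mul_nonneg (Nat.cast_nonneg _) hl0),
      ← Finset.sum_mul, hcard, Fin.card_Iic]
    push_cast
    rw [mul_assoc]
  have : 0 ≤ Γ * R k := by positivity
  gcongr

end ArbeRun

/-! ### The probability of the good event -/

section ArbeRun

variable {X A Ω : Type} {M : ℕ} [MeasurableSpace X] [MeasurableSpace A] [mΩ : MeasurableSpace Ω]
  {B : Environment X A} {L : (i : Fin M) → Learner X (A ⊕ Linked i)} {R : Fin M → ℝ} {c δ : ℝ}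
  {μ : Measure Ω} [Countable A] [MeasurableSingletonClass A] [IsProbabilityMeasure μ]

theorem ArbeRun.toStableRun_received (run : ArbeRun B L R c δ μ) (hR : ∀ i, 0 < R i)
    {s j : Fin M} (hj : s ≤ j) (l : ℕ) (ω : Ω) :
    (run.toStableRun hR s j hj).r l ω ((run.toStableRun hR s j hj).act l ω)
      = run.r l ω (resolve (run.act l ω) j) := by
  change Sum.elim (run.r l ω) (fun k : Linked j => run.r l ω (resolve (run.act l ω) k.1))
    (run.act l ω j) = _
  rw [resolve_eq_elim (run.act l ω) j]
  cases run.act l ω j <;> rfl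

theorem ArbeRun.sum_toStableRun_err (run : ArbeRun B L R c δ μ) (hR : ∀ i, 0 < R i)
    {s j : Fin M} (hj : s ≤ j) (ω : Ω) (t₀ t : ℕ) :
    ∑ l ∈ Finset.Ico t₀ t, (run.toStableRun hR s j hj).err l ω
      = run.estimate ω s j t₀ t - run.reward ω j t₀ t := by
  rw [ArbeRun.estimate, rewardEstimate, ArbeRun.reward, ← Finset.sum_sub_distrib]
  refine Finset.sum_congr rfl fun l _ => ?_
  rw [StableRun.err, run.toStableRun_received]
  congr 1
  change (if decide (run.b l ω = j) = true then _ else _) = _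
  simp only [decide_eq_true_eq]
  split_ifs with h
  · rw [h]
  · rfl

theorem ArbeRun.toStableRun_start (run : ArbeRun B L R c δ μ) (hR : ∀ i, 0 < R i) {T : ℕ} {ω : Ω}
    {j : Fin M} (hj : run.s T ω ≤ j) :
    (run.toStableRun hR (run.s T ω) j hj).start ω = run.start T ω :=
  (run.start_eq_iff rfl _).2 rfl

theorem ArbeRun.le_toStableRun_finish (run : ArbeRun B L R c δ μ) (hR : ∀ i, 0 < R i) {T t : ℕ}
    {ω : Ω} {j : Fin M} (hj : run.s T ω ≤ j) (ht : t ≤ T + 1) :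
    (t : ℕ∞) ≤ (run.toStableRun hR (run.s T ω) j hj).finish ω := by
  refine le_iInf₂ fun l (hl : run.s T ω < run.s l ω) => ?_
  have : T < l := by
    by_contra h
    exact absurd (run.monotone_s ω (not_lt.1 h)) (not_le.2 hl)
  exact_mod_cast (by omega : t ≤ l)

/-- The event that the estimate or the stability bound of base learner `j` fails in the epoch with
smallest active index `s`. -/
def ArbeRun.failure (run : ArbeRun B L R c δ μ) (hR : ∀ i, 0 < R i) (P : Set (Policy X A))
    (s j : Fin M) (hj : s ≤ j) : Set Ω :=
  let sr := run.toStableRun hR s j hj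
  {ω | ¬ ∀ t₀ t : ℕ, sr.start ω = t₀ → t₀ < t → (t : ℕ∞) ≤ sr.finish ω →
      regret (extendClass (Linked j) P) (fun l => sr.x l ω) (fun l => sr.r l ω)
        (fun l => sr.act l ω) t₀ t
        ≤ ((c * (R j * √((t - t₀ : ℝ) / samplingProb R s j * Real.log ((t - t₀ : ℝ) / δ))) : ℝ) :
          EReal)} ∪
  ({ω | ∃ t₀ t : ℕ, sr.start ω = t₀ ∧ t₀ < t ∧ (t : ℕ∞) ≤ sr.finish ω ∧
      confWidth δ (samplingProb R s j) (t - t₀) < 1 * ∑ l ∈ Finset.Ico t₀ t, sr.err l ω} ∪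
  {ω | ∃ t₀ t : ℕ, sr.start ω = t₀ ∧ t₀ < t ∧ (t : ℕ∞) ≤ sr.finish ω ∧
      confWidth δ (samplingProb R s j) (t - t₀) < -1 * ∑ l ∈ Finset.Ico t₀ t, sr.err l ω})

theorem ArbeRun.measure_failure_le (run : ArbeRun B L R c δ μ) (hR : ∀ i, 0 < R i)
    {P : Set (Policy X A)} (h0 : 0 < δ) (h1 : δ < 1) {s j : Fin M} (hj : s ≤ j)
    (hL : ExtHStable B (L j) P (R j) c δ) :
    μ (run.failure hR P s j hj) ≤ ENNReal.ofReal ((1 + 2 * confConst) * δ) := by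
  have hρ := samplingProb_pos hR hj
  have hρ1 := samplingProb_le_one hR s j
  have a1 := hL _ hρ hρ1 Ω μ (run.toStableRun hR s j hj)
  have a2 := (run.toStableRun hR s j hj).measure_exists_err_gt (ε := 1) hρ hρ1 (by simp) h0 h1
  have a3 := (run.toStableRun hR s j hj).measure_exists_err_gt (ε := -1) hρ hρ1 (by simp) h0 h1
  have hc := confConst_nonneg
  calc _ ≤ ENNReal.ofReal δ + (ENNReal.ofReal (δ * confConst) + ENNReal.ofReal (δ * confConst)) :=
        (measure_union_le _ _).trans (add_le_add a1
          ((measure_union_le _ _).trans (add_le_add a2 a3)))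
    _ = _ := by
        rw [← ENNReal.ofReal_add (by positivity) (by positivity),
          ← ENNReal.ofReal_add (by positivity) (by positivity)]
        congr 1; ring

/-- The extended class contains both kinds of competitors: policies of `P` yield `stable`, the
special actions yield `stable_linked`. The signs `1` and `-1` give the two sides of `conf`. -/
theorem ArbeRun.good_of_notMem_failure (run : ArbeRun B L R c δ μ) (hR : ∀ i, 0 < R i)
    {P : Set (Policy X A)} {k : Fin M} {ω : Ω}
    (h : ∀ s j (hj : s ≤ j), k ≤ j → ω ∉ run.failure hR P s j hj) : run.Good k P ω := by
  have hst : ∀ (T t : ℕ) (j : Fin M), k ≤ j → (hj : run.s T ω ≤ j) → run.start T ω < t →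
      t ≤ T + 1 →
      regret (extendClass (Linked j) P) (fun l => run.x l ω)
        (fun l => (run.toStableRun hR (run.s T ω) j hj).r l ω) (fun l => run.act l ω j)
        (run.start T ω) t
        ≤ ((c * (R j * √((t - run.start T ω : ℝ) / samplingProb R (run.s T ω) j
          * Real.log ((t - run.start T ω : ℝ) / δ))) : ℝ) : EReal) := by
    intro T t j hkj hj hlt ht
    have hf := h _ j hj hkj
    simp only [ArbeRun.failure, Set.mem_union, not_or, Set.mem_ofPred_eq, not_not] at hf
    exact hf.1 _ _ (run.toStableRun_start hR hj) hlt (run.le_toStableRun_finish hR hj ht)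
  refine ⟨fun T t j hkj hj hlt ht => ?_, fun T t j hkj hj hlt ht π hπ => ?_,
    fun T t j hkj hj hlt ht i hji => ?_⟩
  · have hf := h _ j hj hkj
    simp only [ArbeRun.failure, Set.mem_union, not_or, Set.mem_ofPred_eq, not_exists, not_and,
      not_lt, run.sum_toStableRun_err hR hj] at hf
    have h1 := hf.2.1 _ _ (run.toStableRun_start hR hj) hlt (run.le_toStableRun_finish hR hj ht)
    have h2 := hf.2.2 _ _ (run.toStableRun_start hR hj) hlt (run.le_toStableRun_finish hR hj ht)
    exact abs_le.2 ⟨by linarith, by linarith⟩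
  · have h1 := sum_le_of_regret_le (hst T t j hkj hj hlt ht) (Or.inl ⟨π, hπ, rfl⟩)
    have e : ∀ l, (run.toStableRun hR (run.s T ω) j hj).r l ω (run.act l ω j)
        = run.r l ω (resolve (run.act l ω) j) := fun l => run.toStableRun_received hR hj l ω
    simp only [e, Policy.value_extend] at h1
    rw [Finset.sum_sub_distrib] at h1
    exact h1
  · have h1 := sum_le_of_regret_le (hst T t j hkj hj hlt ht)
      (Or.inr ⟨(⟨i, hji⟩ : Linked j), rfl⟩)
    have e : ∀ l, (run.toStableRun hR (run.s T ω) j hj).r l ω (run.act l ω j)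
        = run.r l ω (resolve (run.act l ω) j) := fun l => run.toStableRun_received hR hj l ω
    simp only [e, Policy.value_special] at h1
    rw [Finset.sum_sub_distrib] at h1
    exact h1

/-- A union bound over the label of the epoch and the learner. The labels are deterministic although
the epochs are random intervals, so M² failure events suffice for all times. -/
theorem ArbeRun.measure_not_good_le (run : ArbeRun B L R c δ μ) (hR : ∀ i, 0 < R i)
    {P : Set (Policy X A)} (h0 : 0 < δ) (h1 : δ < 1) {k : Fin M}
    (hL : ∀ j, k ≤ j → ExtHStable B (L j) P (R j) c δ) :
    μ {ω | ¬ run.Good k P ω} ≤ ENNReal.ofReal ((1 + 2 * confConst) * M ^ 2 * δ) := by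
  have hc := confConst_nonneg
  calc _ ≤ μ (⋃ s : Fin M, ⋃ j : Fin M, {ω | ∃ hj : s ≤ j, k ≤ j ∧ ω ∈ run.failure hR P s j hj}) := by
        refine measure_mono fun ω hω => ?_
        by_contra hn
        simp only [Set.mem_iUnion, Set.mem_ofPred_eq, not_exists, not_and] at hn
        exact hω (run.good_of_notMem_failure hR hn)
    _ ≤ ∑ _s : Fin M, ∑ _j : Fin M, ENNReal.ofReal ((1 + 2 * confConst) * δ) := by
        refine (measure_iUnion_fintype_le _ _).trans (Finset.sum_le_sum fun s _ =>
          (measure_iUnion_fintype_le _ _).trans (Finset.sum_le_sum fun j _ => ?_))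
        by_cases hj : s ≤ j ∧ k ≤ j
        · exact (measure_mono fun ω hω => hω.2.2).trans
            (run.measure_failure_le hR h0 h1 hj.1 (hL j hj.2))
        · have : {ω | ∃ hj : s ≤ j, k ≤ j ∧ ω ∈ run.failure hR P s j hj} = ∅ := by
            ext ω
            simp only [Set.mem_ofPred_eq, Set.mem_empty_iff_false, iff_false]
            exact fun h => hj ⟨h.1, h.2.1⟩
          rw [this, measure_empty]
          exact zero_le
    _ = _ := by
        simp only [Finset.sum_const, Finset.card_univ, Fintype.card_fin, nsmul_eq_mul]
        rw [← ENNReal.ofReal_natCast, ← ENNReal.ofReal_mul (by positivity),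
          ← ENNReal.ofReal_mul (by positivity)]
        congr 1; ring

end ArbeRun

/-! ### The regret bound. -/

theorem mainTheorem1 :
    ∃ p : Polynomial ℝ, ∀ c : ℝ, 0 < c → ∃ C : ℝ, 0 < C ∧
      ∀ (X A : Type) [MeasurableSpace X] [MeasurableSpace A] [Countable A]
        [MeasurableSingletonClass A] (M : ℕ) [NeZero M]
        (B : Environment X A)
        (P : Fin M → Set (Policy X A)) (_ : Monotone P)
        (L : (i : Fin M) → Learner X (A ⊕ Linked i))
        (_ : ∀ i, extendClass (Linked i) (P i) ⊆ (L i).policyClass)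
        (R : Fin M → ℝ) (_ : 1 ≤ R 0) (_ : Monotone R)
        (δ : ℝ) (_ : 0 < δ) (_ : δ < 1)
        (istar : Fin M)
        (_ : IsLeast {i | ∀ j, i ≤ j → ExtHStable B (L j) (P (⊤)) (R j) c δ} istar)
        (Ω : Type) [MeasurableSpace Ω] (μ : Measure Ω) [IsProbabilityMeasure μ]
        (run : ArbeRun B L R c δ μ),
        μ {ω | ¬ ∀ t : ℕ, (istar : ℕ) + 1 ≤ t →
            regret (P (⊤)) (fun l => run.x l ω) (fun l => run.r l ω)
                (fun l => run.played l ω) 0 t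
              ≤ ((C * ((R istar / R 0 * √((istar : ℝ) + 1) + M) * R istar
                  * √(((istar : ℝ) + 1) * t * Real.log (t / δ))) : ℝ) : EReal)}
          ≤ ENNReal.ofReal (p.eval (M : ℝ) * δ) := by
  have hκ := confConst_nonneg
  -- The quadratic term comes from the union bound. The summand 3 makes the claim trivial for `δ > 1
  -- / 3`, where the logarithmic comparisons are not available.
  refine ⟨Polynomial.C (1 + 2 * confConst) * Polynomial.X ^ 2 + Polynomial.C 3, fun c hc =>
    ⟨2 * c + 20, by positivity, ?_⟩⟩
  intro X A _ _ _ _ M _ B P _ L _ R hR0 hmono δ h0 h1 istar hleast Ω _ μ _ run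
  have hR : ∀ i, 1 ≤ R i := fun i => hR0.trans (hmono (Fin.zero_le i))
  have hR' : ∀ i, 0 < R i := fun i => zero_lt_one.trans_le (hR i)
  simp only [Polynomial.eval_add, Polynomial.eval_mul, Polynomial.eval_C, Polynomial.eval_pow,
    Polynomial.eval_X]
  have hpos : 0 ≤ (1 + 2 * confConst) * (M : ℝ) ^ 2 := by positivity
  rcases le_or_gt δ (1 / 3) with h3 | h3
  · refine (measure_mono (t := {ω | ¬ run.Good istar (P ⊤) ω}) fun ω hω hg => ?_).trans
      ((run.measure_not_good_le hR' h0 h1 hleast.1).trans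
        (ENNReal.ofReal_le_ofReal (by nlinarith)))
    rw [Set.mem_ofPred_eq] at hω
    exact hω fun t _ => hg.regret_le hc.le hR hmono h0 h3 t
  · refine prob_le_one.trans ?_
    rw [← ENNReal.ofReal_one]
    exact ENNReal.ofReal_le_ofReal (by nlinarith)
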